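/- Let $\mathcal S(]-\infty,0])$ be the space of $C^\infty$ functions $F:\,]-\infty,0]\to\mathbb C$ (one-sidedly smooth at $0$) such that $|t|^mF^{(n)}(t)\to 0$ as $t\to-\infty$ for all integers $m,n\ge 0$. For such $F$, let $s\mapsto F^{(s)}(0)$ be the (unique) entire function on $\mathbb C$ that satisfies $$F^{(s)}(0)=\frac1{\Gamma(-s)}\int_0^{+\infty}u^{-s-1}F(-u)\,du\qquad(\Re s<0).$$ This entire function exists for every $F\in\mathcal S(]-\infty,0])$. Let $d_n$ be the number of positive divisors of $n$, and let $\gamma$ be Euler's constant. For $c\in\mathbb R$, $\int_{\Re s=c}$ denotes the integral along the vertical line from $c-i\infty$ to $c+i\infty$. (Euler–Voronoï formula) Let $F\in\mathcal S(]-\infty,0])$ and $t<0$. Then $\sum_{n\ge1}d_nF(nt)$ converges absolutely and $$\sum_{n=1}^{+\infty}d_nF(nt)=\frac1{2i\pi}\int_{\Re s=3/2}\zeta(s)^2\,\Gamma(s)\,F^{(-s)}(0)\,(-t)^{-s}\,ds=\frac1{2i\pi}\int_{\Re s=-3/2}\zeta(-s)^2\,\Gamma(-s)\,F^{(s)}(0)\,(-t)^{s}\,ds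 ,$$ and for every integer $N\ge1$, $$\sum_{n=1}^{+\infty}d_nF(nt)=-\frac1t\int_0^{+\infty}F(-u)\Big(\ln\frac{u}{-t}+2\gamma\Big)du+\frac{F(0)}4+\sum_{n=1}^{N}\frac{\zeta(1-2n)^2}{(2n-1)!}\,t^{2n-1}F^{(2n-1)}(0)+\frac1{2i\pi}\int_{\Re s=2N}\Gamma(-s)\,\zeta(-s)^2\,F^{(s)}(0)\,(-t)^{s}\,ds .$$ All the integrals above converge absolutely (on the line $\Re s=2N$ the integrand has a removable singularity at $s=2N$), and in the finite sum $F^{(2n-1)}(0)$ is the ordinary (one-sided) derivative. -/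

import Mathlib

open scoped ContDiff

/-- `F` belongs to the space `S(]-∞, a], ℂ)`: it is `C^∞` on `]-∞, a]` (one-sidedly at `a`) and
`|t|^m F^{(n)}(t) → 0` as `t → -∞` for all `m` and `n`. Only the values of `F` on `]-∞, a]`
matter. -/
structure HalfLineSchwartz (a : ℝ) (F : ℝ → ℂ) : Prop where
  smooth : ContDiffOn ℝ ∞ F (Set.Iic a)
  decay : ∀ m n : ℕ, Filter.Tendsto
    (fun t : ℝ => ((|t| ^ m : ℝ) : ℂ) * iteratedDerivWithin n F (Set.Iic a) t)
    Filter.atBot (nhds 0)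

/-- The Riemann-Liouville derivative of order `s` at `0` (an absolutely convergent integral
for `Re s < 0`): `1/Γ(-s) ∫_0^∞ u^{-s-1} F(-u) du`. -/
noncomputable def riemannLiouville (F : ℝ → ℂ) (s : ℂ) : ℂ :=
  1 / Complex.Gamma (-s) * ∫ u in Set.Ioi (0 : ℝ), (u : ℂ) ^ (-s - 1) * F (-u)

/-- `D` is an entire function that extends `s ↦ riemannLiouville F s` from `Re s < 0`. -/
structure IsEntireFracDeriv (F : ℝ → ℂ) (D : ℂ → ℂ) : Prop where
  entire : Differentiable ℂ D
  eq_of_re_neg : ∀ s : ℂ, s.re < 0 → D s = riemannLiouville F s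

/-- There is at most one entire extension. -/
theorem IsEntireFracDeriv.unique {F : ℝ → ℂ} {D E : ℂ → ℂ}
    (hD : IsEntireFracDeriv F D) (hE : IsEntireFracDeriv F E) : D = E := by
  have hD' : AnalyticOnNhd ℂ D Set.univ := fun z _ => hD.entire.analyticAt z
  have hE' : AnalyticOnNhd ℂ E Set.univ := fun z _ => hE.entire.analyticAt z
  refine hD'.eq_of_eventuallyEq (z₀ := -1) hE' ?_
  have ho : IsOpen {s : ℂ | s.re < 0} := isOpen_lt Complex.continuous_re continuous_const
  filter_upwards [ho.mem_nhds (show (-1 : ℂ) ∈ {s : ℂ | s.re < 0} by simp)] with s hs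
  rw [hD.eq_of_re_neg s hs, hE.eq_of_re_neg s hs]

/-- The fractional derivative `F^{(s)}(0)`, `s ∈ ℂ`: the entire extension of the
Riemann-Liouville derivative. -/
noncomputable def fracDerivZero (F : ℝ → ℂ) : ℂ → ℂ :=
  Classical.epsilon (IsEntireFracDeriv F)

/-- `(1 / 2iπ) ∫_{Re s = c} f(s) ds` along the upward oriented line `s = c + iy`, `ds = i dy`. -/
noncomputable def verticalLineIntegral (c : ℝ) (f : ℂ → ℂ) : ℂ :=
  1 / (2 * (Real.pi : ℂ) * Complex.I) *
    ∫ y : ℝ, f ((c : ℂ) + (y : ℂ) * Complex.I) * Complex.I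

/-! The sum is a Mellin–Barnes integral whose contour is moved to the left. Let `M` be the Mellin
transform of `u ↦ F(-u)`. For `Re w > 0` one has `Γ(w) F^{(-w)}(0) = M(w)`. With `x = -t`, Mellin
inversion of each `F(-nx)` on `Re w = 3/2`, where `∑ d_n n^{-w} = ζ(w)²` converges absolutely, gives
the sum as the integral of `voronoiIntegrand`, that is, `ζ(w)² Γ(w) F^{(-w)}(0) x^{-w}`.

Repeated integration by parts gives `Γ(w) F^{(-w)}(0) = M_K(w + K) / (w(w+1)⋯(w+K-1))` for `Re w >
-K`, with `M_K` the Mellin transform of `u ↦ F^{(K)}(-u)`. This one formula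
(`Gamma_mul_fracDerivZero_neg`) provides the continuation, the poles at `0, -1, -2, …` and decay
faster than any power of `|Im w|` on strips. Since `ζ` grows at most polynomially there
(`exists_norm_riemannZeta_le_pow`, by Phragmén–Lindelöf), the integrand is `O(|Im w|⁻²)` and
contours may be shifted.

The double pole at `w = 1` yields the logarithmic integral, because `(w - 1)ζ(w)` has value `1` and
derivative `γ` there. The simple pole at `-k` yields `ζ(-k)² (-x)^k F^{(k)}(0) / k!`, which is
`F(0)/4` for `k = 0` and vanishes for even `k ≥ 2`. At `w = -2N` the double zero of `ζ²` absorbs the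
pole of `Γ`, so the last line may pass through that point. The substitution `s = -w` gives the
remaining forms. -/

section EulerVoronoi

open Set Filter Topology Complex MeasureTheory Asymptotics

/-! ### Mellin transforms of half-line Schwartz functions and integration by parts. -/

namespace HalfLineSchwartz

variable {F : ℝ → ℂ}

theorem derivWithin {a : ℝ} (hF : HalfLineSchwartz a F) :
    HalfLineSchwartz a (derivWithin F (Iic a)) where
  smooth := hF.smooth.derivWithin (uniqueDiffOn_Iic a) (by simp)
  decay m n := by
    simpa only [iteratedDerivWithin_succ'] using hF.decay m (n + 1)

theorem iteratedDerivWithin {a : ℝ} (hF : HalfLineSchwartz a F) (k : ℕ) :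
    HalfLineSchwartz a (iteratedDerivWithin k F (Iic a)) := by
  induction k generalizing F with
  | zero => simpa using hF
  | succ k ih =>
    rw [iteratedDerivWithin_succ']
    exact ih hF.derivWithin

theorem hasDerivAt (hF : HalfLineSchwartz 0 F) {u : ℝ} (hu : 0 < u) :
    HasDerivAt (fun u => F (-u)) (-_root_.derivWithin F (Iic 0) (-u)) u := by
  have h1 : HasDerivWithinAt F (_root_.derivWithin F (Iic 0) (-u)) (Iic 0) (-u) :=
    ((hF.smooth.differentiableOn (by simp)) (-u) (by simp [hu.le])).hasDerivWithinAt
  have h2 : HasDerivAt F (_root_.derivWithin F (Iic 0) (-u)) (-u) :=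
    h1.hasDerivAt (Iic_mem_nhds (by linarith))
  simpa [Function.comp_def] using h2.scomp u (hasDerivAt_neg u)

theorem continuousOn_comp_neg (hF : HalfLineSchwartz 0 F) :
    ContinuousOn (fun u => F (-u)) (Ici 0) :=
  hF.smooth.continuousOn.comp continuousOn_neg fun u hu => by simpa using hu

theorem tendsto_pow_mul_comp_neg (hF : HalfLineSchwartz 0 F) (m : ℕ) :
    Tendsto (fun u : ℝ => (u : ℂ) ^ m * F (-u)) atTop (𝓝 0) := by
  have := (hF.decay m 0).comp tendsto_neg_atTop_atBot
  refine this.congr' ?_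
  filter_upwards [eventually_ge_atTop 0] with u hu
  simp [abs_of_nonneg hu]

theorem isBigO_atTop (hF : HalfLineSchwartz 0 F) (a : ℝ) :
    (fun u => F (-u)) =O[atTop] fun u : ℝ => u ^ (-a) := by
  obtain ⟨m, hm⟩ := exists_nat_ge a
  have h1 := (hF.tendsto_pow_mul_comp_neg m).isBigO_one ℝ
  have h2 : (fun u => F (-u)) =O[atTop] fun u : ℝ => u ^ (-(m : ℝ)) := by
    have h3 := (isBigO_refl (fun u : ℝ => u ^ (-(m : ℝ))) atTop).smul h1
    refine h3.congr' ?_ ?_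
    · filter_upwards [eventually_gt_atTop 0] with u hu
      have : (u : ℂ) ≠ 0 := by exact_mod_cast hu.ne'
      rw [Real.rpow_neg hu.le, Real.rpow_natCast, real_smul]
      push_cast
      field_simp
    · simp
  refine h2.trans (IsBigO.of_bound 1 ?_)
  filter_upwards [eventually_ge_atTop 1] with u hu
  rw [one_mul, Real.norm_of_nonneg (by positivity), Real.norm_of_nonneg (by positivity)]
  exact Real.rpow_le_rpow_of_exponent_le hu (by linarith)

/-- The exponent `-0` is the shape that the Mellin convergence criteria expect: boundedness at `0`
gives convergence for `Re z > 0`. -/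
theorem isBigO_nhdsGT (hF : HalfLineSchwartz 0 F) :
    (fun u => F (-u)) =O[𝓝[>] 0] fun u : ℝ => u ^ (-(0 : ℝ)) := by
  have h := (hF.continuousOn_comp_neg 0 (by simp)).mono Ioi_subset_Ici_self
  simpa using h.tendsto.isBigO_one ℝ

theorem locallyIntegrableOn (hF : HalfLineSchwartz 0 F) :
    LocallyIntegrableOn (fun u => F (-u)) (Ioi 0) :=
  (hF.continuousOn_comp_neg.mono Ioi_subset_Ici_self).locallyIntegrableOn measurableSet_Ioi

theorem mellinConvergent (hF : HalfLineSchwartz 0 F) {z : ℂ} (hz : 0 < z.re) :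
    MellinConvergent (fun u => F (-u)) z :=
  mellinConvergent_of_isBigO_rpow hF.locallyIntegrableOn (hF.isBigO_atTop (z.re + 1))
    (by linarith) hF.isBigO_nhdsGT hz

theorem mellin_hasDerivAt (hF : HalfLineSchwartz 0 F) {z : ℂ} (hz : 0 < z.re) :
    MellinConvergent (fun u => Real.log u • F (-u)) z ∧
      HasDerivAt (mellin fun u => F (-u)) (mellin (fun u => Real.log u • F (-u)) z) z :=
  mellin_hasDerivAt_of_isBigO_rpow hF.locallyIntegrableOn (hF.isBigO_atTop (z.re + 1))
    (by linarith) hF.isBigO_nhdsGT hz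

theorem differentiableAt_mellin (hF : HalfLineSchwartz 0 F) {z : ℂ} (hz : 0 < z.re) :
    DifferentiableAt ℂ (mellin fun u => F (-u)) z :=
  (hF.mellin_hasDerivAt hz).2.differentiableAt

/-- Integration by parts against `u^z / z`. The minus sign of the formula cancels the one from
differentiating `F(-u)`, and the boundary terms vanish by `Re z > 0` at `0` and by rapid decay at
infinity. -/
theorem mellin_eq_mellin_derivWithin (hF : HalfLineSchwartz 0 F) {z : ℂ} (hz : 0 < z.re) :
    mellin (fun u => F (-u)) z =
      mellin (fun u => _root_.derivWithin F (Iic 0) (-u)) (z + 1) / z := by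
  have hz0 : z ≠ 0 := fun h => by simp [h] at hz
  have hu : ∀ u ∈ Ioi (0 : ℝ), HasDerivAt (fun u : ℝ => (u : ℂ) ^ z / z) ((u : ℂ) ^ (z - 1)) u :=
    fun u hu => by
      have := (hasDerivAt_ofReal_cpow_const (r := z) (ne_of_gt hu) hz0).div_const z
      simpa [hz0] using this
  have hc := hF.mellinConvergent hz
  have hc' := hF.derivWithin.mellinConvergent (z := z + 1) (by simp; linarith)
  unfold MellinConvergent at hc hc'
  simp only [add_sub_cancel_right, smul_eq_mul] at hc hc'
  have hnorm : ∀ u : ℝ, 0 < u → ‖(u : ℂ) ^ z / z * F (-u)‖ = u ^ z.re / ‖z‖ * ‖F (-u)‖ := by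
    intro u hu
    rw [norm_mul, norm_div, norm_cpow_eq_rpow_re_of_pos hu]
  have key := integral_Ioi_mul_deriv_eq_deriv_mul (a := 0) (a' := 0) (b' := 0)
    (u := fun u : ℝ => (u : ℂ) ^ z / z) (v := fun u : ℝ => F (-u))
    (u' := fun u : ℝ => (u : ℂ) ^ (z - 1)) (v' := fun u => -_root_.derivWithin F (Iic 0) (-u))
    hu (fun u hu => hF.hasDerivAt hu) ?_ hc ?_ ?_
  · simp only [mellin, smul_eq_mul, add_sub_cancel_right]
    have h2 : ∀ u : ℝ, (u : ℂ) ^ z / z * -_root_.derivWithin F (Iic 0) (-u) =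
        - ((u : ℂ) ^ z * _root_.derivWithin F (Iic 0) (-u) / z) := fun u => by ring
    simp only [h2, integral_neg, integral_div] at key
    linear_combination key
  · refine (hc'.neg.div_const z).congr (ae_of_all _ fun u => ?_)
    simp only [Pi.mul_apply, Pi.neg_apply]
    ring
  · have h1 : Tendsto (fun u : ℝ => (u : ℂ) ^ z / z) (𝓝[>] 0) (𝓝 0) := by
      have : ContinuousAt (fun u : ℝ => (u : ℂ) ^ z / z) 0 :=
        (continuousAt_ofReal_cpow_const 0 z (Or.inl hz)).div_const z
      have h := this.tendsto.mono_left (nhdsWithin_le_nhds (s := Ioi 0))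
      simpa [hz0] using h
    have h2 := (hF.continuousOn_comp_neg 0 (by simp)).mono Ioi_subset_Ici_self
    simpa [Pi.mul_def] using h1.mul h2.tendsto
  · obtain ⟨m, hm⟩ := exists_nat_ge z.re
    have h1 := ((hF.tendsto_pow_mul_comp_neg m).norm).div_const ‖z‖
    simp only [norm_zero, zero_div] at h1
    refine squeeze_zero_norm' ?_ h1
    filter_upwards [eventually_ge_atTop 1] with u hu
    have hu0 : 0 < u := by linarith
    simp only [Pi.mul_apply]
    rw [hnorm u hu0, norm_mul, norm_pow, norm_real, Real.norm_of_nonneg hu0.le, div_mul_eq_mul_div]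
    gcongr
    exact_mod_cast Real.rpow_le_rpow_of_exponent_le hu hm

theorem mellin_derivWithin_one (hF : HalfLineSchwartz 0 F) :
    mellin (fun u => _root_.derivWithin F (Iic 0) (-u)) 1 = F 0 := by
  have hc' := hF.derivWithin.mellinConvergent (z := 1) (by simp)
  simp only [MellinConvergent, sub_self, cpow_zero, one_smul] at hc'
  have h0 : Tendsto (fun u => F (-u)) atTop (𝓝 0) := by
    simpa using hF.tendsto_pow_mul_comp_neg 0
  have := integral_Ioi_of_hasDerivAt_of_tendsto (a := 0)
    (hF.continuousOn_comp_neg 0 (by simp)) (fun u hu => hF.hasDerivAt hu) hc'.neg h0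
  rw [integral_neg] at this
  simp only [mellin, sub_self, cpow_zero, one_smul]
  simp only [neg_zero] at this
  linear_combination -this

theorem mellin_iteratedDerivWithin_succ_one (hF : HalfLineSchwartz 0 F) (k : ℕ) :
    mellin (fun u => _root_.iteratedDerivWithin (k + 1) F (Iic 0) (-u)) 1 =
      _root_.iteratedDerivWithin k F (Iic 0) 0 := by
  simpa only [iteratedDerivWithin_succ] using (hF.iteratedDerivWithin k).mellin_derivWithin_one

theorem mellin_eq_mellin_iteratedDerivWithin (hF : HalfLineSchwartz 0 F) {z : ℂ} (hz : 0 < z.re)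
    (k : ℕ) : mellin (fun u => F (-u)) z =
      mellin (fun u => _root_.iteratedDerivWithin k F (Iic 0) (-u)) (z + k) /
        ∏ j ∈ Finset.range k, (z + j) := by
  induction k with
  | zero => simp
  | succ k ih =>
    rw [ih, (hF.iteratedDerivWithin k).mellin_eq_mellin_derivWithin
      (by simp; positivity), Finset.prod_range_succ, ← iteratedDerivWithin_succ, div_div]
    push_cast
    rw [add_assoc, mul_comm]

end HalfLineSchwartz

/-! ### Bounds on vertical strips and quotients of Gamma values. -/

/-- For `a ≤ σ ≤ b`, `t^(σ-1)` is at most `t^(a-1) + t^(b-1)`, so convergence at the two edges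
dominates the whole strip. -/
theorem exists_norm_mellin_le {f : ℝ → ℂ} {a b : ℝ} (ha : MellinConvergent f a)
    (hb : MellinConvergent f b) : ∃ C : ℝ, ∀ z : ℂ, a ≤ z.re → z.re ≤ b → ‖mellin f z‖ ≤ C := by
  have hnorm : ∀ (c : ℂ) (t : ℝ), 0 < t → ‖(t : ℂ) ^ (c - 1) • f t‖ = t ^ (c.re - 1) * ‖f t‖ := by
    intro c t ht
    rw [norm_smul, norm_cpow_eq_rpow_re_of_pos ht, sub_re, one_re]
  refine ⟨∫ t in Ioi (0 : ℝ), (‖(t : ℂ) ^ ((a : ℂ) - 1) • f t‖ + ‖(t : ℂ) ^ ((b : ℂ) - 1) • f t‖),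
    fun z haz hzb => ?_⟩
  rw [mellin]
  refine norm_integral_le_of_norm_le (ha.norm.add hb.norm) ?_
  filter_upwards [ae_restrict_mem measurableSet_Ioi] with t ht
  rw [hnorm _ _ ht, hnorm _ _ ht, hnorm _ _ ht, ofReal_re, ofReal_re, ← add_mul]
  refine mul_le_mul_of_nonneg_right ?_ (norm_nonneg _)
  have ht0 : 0 < t := ht
  rcases le_total 1 t with h | h
  · have := Real.rpow_le_rpow_of_exponent_le h (show z.re - 1 ≤ b - 1 by linarith)
    have := Real.rpow_nonneg ht0.le (a - 1)
    linarith
  · have := Real.rpow_le_rpow_of_exponent_ge ht0 h (show a - 1 ≤ z.re - 1 by linarith)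
    have := Real.rpow_nonneg ht0.le (b - 1)
    linarith

theorem riemannLiouville_eq_mellin (F : ℝ → ℂ) (s : ℂ) :
    riemannLiouville F s = (Gamma (-s))⁻¹ * mellin (fun u => F (-u)) (-s) := by
  simp [riemannLiouville, mellin]

/-- The identity survives at the poles of the numerator: there `Gamma` takes the default value `0`,
and the product contains a zero factor whose inverse is `0`. Hence later formulas need no exclusion
of `w = -m`. -/
theorem Complex.Gamma_div_Gamma_add_natCast {w : ℂ} {K : ℕ} (h : Gamma (w + K) ≠ 0) :
    Gamma w * (Gamma (w + K))⁻¹ = (∏ j ∈ Finset.range K, (w + j))⁻¹ := by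
  by_cases h0 : ∃ m : ℕ, w = -m
  · obtain ⟨m, rfl⟩ := h0
    have hm : m < K := by
      by_contra hm
      refine h ?_
      rw [show (-(m : ℂ) + K) = -((m - K : ℕ) : ℂ) by push_cast [Nat.cast_sub (not_lt.1 hm)]; ring]
      exact Gamma_neg_nat_eq_zero _
    rw [Gamma_neg_nat_eq_zero, zero_mul, Finset.prod_eq_zero (Finset.mem_range.2 hm) (by simp),
      inv_zero]
  · push Not at h0
    have key : ∀ K : ℕ, Gamma (w + K) = (∏ j ∈ Finset.range K, (w + j)) * Gamma w := by
      intro K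
      induction K with
      | zero => simp
      | succ K ih =>
        rw [Finset.prod_range_succ, Nat.cast_succ, ← add_assoc, Gamma_add_one _ ?_, ih]
        · ring
        · exact fun h => h0 K (by linear_combination h)
    rw [key, mul_inv_rev, mul_inv_cancel_left₀ (Gamma_ne_zero h0)]

/-! ### The entire function `s ↦ F^{(s)}(0)` and its decay. -/

namespace HalfLineSchwartz

variable {F : ℝ → ℂ}

theorem riemannLiouville_eq_iteratedDerivWithin (hF : HalfLineSchwartz 0 F) {s : ℂ} (hs : s.re < 0)
    (k : ℕ) :
    riemannLiouville F s = riemannLiouville (_root_.iteratedDerivWithin k F (Iic 0)) (s - k) := by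
  have hz : 0 < (-s).re := by simpa using hs
  have h := Gamma_div_Gamma_add_natCast (w := -s) (K := k)
    (Gamma_ne_zero_of_re_pos (by simp; linarith [hs, Nat.cast_nonneg (α := ℝ) k]))
  rw [riemannLiouville_eq_mellin, riemannLiouville_eq_mellin,
    hF.mellin_eq_mellin_iteratedDerivWithin hz k, show -(s - k) = -s + k by ring, div_eq_mul_inv, ← h]
  field_simp [Gamma_ne_zero_of_re_pos hz]

theorem differentiableAt_riemannLiouville (hF : HalfLineSchwartz 0 F) {s : ℂ} (hs : s.re < 0) :
    DifferentiableAt ℂ (riemannLiouville F) s := by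
  rw [funext (riemannLiouville_eq_mellin F)]
  have hz : 0 < (-s).re := by simpa using hs
  exact ((differentiable_one_div_Gamma (-s)).comp s differentiable_neg.differentiableAt).mul
    ((hF.differentiableAt_mellin hz).comp s differentiable_neg.differentiableAt)

/-- The Riemann–Liouville integrals of `F^{(k)}` at `s - k` are holomorphic on `Re s < k` and agree
on overlaps, so they glue to an entire function. -/
theorem exists_isEntireFracDeriv (hF : HalfLineSchwartz 0 F) :
    ∃ D : ℂ → ℂ, IsEntireFracDeriv F D := by
  let E : ℕ → ℂ → ℂ := fun k s =>
    riemannLiouville (_root_.iteratedDerivWithin k F (Iic 0)) (s - k)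
  have hE : ∀ k l : ℕ, ∀ s : ℂ, s.re < k → E k s = E (k + l) s := by
    intro k l s hs
    have := (hF.iteratedDerivWithin k).riemannLiouville_eq_iteratedDerivWithin (s := s - k)
      (by simpa using hs) l
    have hit : ∀ (n : ℕ) (G : ℝ → ℂ), _root_.iteratedDerivWithin n G (Iic 0) =
        (fun g => _root_.derivWithin g (Iic 0))^[n] G :=
      fun n G => funext fun x => iteratedDerivWithin_eq_iterate
    simp only [E]
    rw [this, hit, hit, hit, ← Function.iterate_add_apply, add_comm l k, Nat.cast_add, sub_sub]
  have hE' : ∀ (j k : ℕ) (s : ℂ), j ≤ k → s.re < j → E j s = E k s := by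
    intro j k s hjk hs
    obtain ⟨l, rfl⟩ := Nat.exists_eq_add_of_le hjk
    exact hE j l s hs
  -- The index `⌊s.re⌋₊ + 1` exceeds `s.re`, also for negative `s.re`, where the floor is `0`. It
  -- varies with `s`; for differentiability it is replaced by the fixed index `⌊s.re⌋₊ + 2`, valid
  -- on all of `Re z < Re s + 1`.
  refine ⟨fun s => E (⌊s.re⌋₊ + 1) s, ⟨fun s => ?_, fun s hs => ?_⟩⟩
  · have hk : s.re < (⌊s.re⌋₊ + 2 : ℕ) := by push_cast; linarith [Nat.lt_floor_add_one s.re]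
    have hd : DifferentiableAt ℂ (E (⌊s.re⌋₊ + 2)) s :=
      ((hF.iteratedDerivWithin _).differentiableAt_riemannLiouville
        (by simpa using hk)).comp s (differentiableAt_id.sub_const _)
    refine hd.congr_of_eventuallyEq ?_
    have ho : IsOpen {z : ℂ | z.re < s.re + 1} := isOpen_lt continuous_re continuous_const
    filter_upwards [ho.mem_nhds (show s ∈ {z : ℂ | z.re < s.re + 1} by simp)] with z hz
    refine hE' _ _ z ?_ (by push_cast; exact Nat.lt_floor_add_one z.re)
    have : ⌊z.re⌋₊ < ⌊s.re⌋₊ + 2 := by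
      rw [Nat.floor_lt' (by simp)]
      push_cast
      have := Nat.lt_floor_add_one s.re
      have h2 : z.re < s.re + 1 := hz
      linarith
    omega
  · have := hE' 0 (⌊s.re⌋₊ + 1) s (by simp) (by simpa using hs)
    simp only [← this, E, iteratedDerivWithin_zero, Nat.cast_zero, sub_zero]

theorem isEntireFracDeriv_fracDerivZero (hF : HalfLineSchwartz 0 F) :
    IsEntireFracDeriv F (fracDerivZero F) :=
  Classical.epsilon_spec hF.exists_isEntireFracDeriv

/-- The shifted function attached to `F^{(k)}` is another entire extension for `F`, so uniqueness
identifies the two. -/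
theorem fracDerivZero_eq_riemannLiouville (hF : HalfLineSchwartz 0 F) {s : ℂ} {k : ℕ}
    (hs : s.re < k) : fracDerivZero F s =
      riemannLiouville (_root_.iteratedDerivWithin k F (Iic 0)) (s - k) := by
  have hk := hF.iteratedDerivWithin k
  have h1 : IsEntireFracDeriv F
      (fun s => fracDerivZero (_root_.iteratedDerivWithin k F (Iic 0)) (s - k)) := by
    refine ⟨hk.isEntireFracDeriv_fracDerivZero.entire.comp (differentiable_id.sub_const _),
      fun s hs => ?_⟩
    rw [hF.riemannLiouville_eq_iteratedDerivWithin hs k]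
    exact hk.isEntireFracDeriv_fracDerivZero.eq_of_re_neg _
      (by simp; linarith [hs, Nat.cast_nonneg (α := ℝ) k])
  rw [hF.isEntireFracDeriv_fracDerivZero.unique h1]
  exact hk.isEntireFracDeriv_fracDerivZero.eq_of_re_neg _ (by simpa using hs)

theorem Gamma_mul_fracDerivZero_neg (hF : HalfLineSchwartz 0 F) {w : ℂ} {K : ℕ}
    (hw : -(K : ℝ) < w.re) : Gamma w * fracDerivZero F (-w) =
      mellin (fun u => _root_.iteratedDerivWithin K F (Iic 0) (-u)) (w + K) /
        ∏ j ∈ Finset.range K, (w + j) := by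
  rw [hF.fracDerivZero_eq_riemannLiouville (k := K) (by simp; linarith),
    riemannLiouville_eq_mellin, ← mul_assoc, show -(-w - K) = w + K by ring,
    Gamma_div_Gamma_add_natCast (Gamma_ne_zero_of_re_pos (by simp; linarith))]
  ring

theorem Gamma_mul_fracDerivZero_neg_of_re_pos (hF : HalfLineSchwartz 0 F) {w : ℂ} (hw : 0 < w.re) :
    Gamma w * fracDerivZero F (-w) = mellin (fun u => F (-u)) w := by
  simpa using hF.Gamma_mul_fracDerivZero_neg (K := 0) (by simpa using hw)

theorem exists_norm_Gamma_mul_fracDerivZero_le (hF : HalfLineSchwartz 0 F) (a b : ℝ) (m : ℕ) :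
    ∃ C : ℝ, 0 ≤ C ∧ ∀ w : ℂ, a ≤ w.re → w.re ≤ b → 1 ≤ |w.im| →
      ‖Gamma w * fracDerivZero F (-w)‖ ≤ C / |w.im| ^ m := by
  obtain ⟨n, hn⟩ := exists_nat_gt (-a)
  -- The summand `n` brings the strip into `Re w > -K`; the summand `m` ensures at least `m` factors
  -- `w + j`, each of modulus at least `|w.im|`.
  let K := n + m
  have hK : -(K : ℝ) < a := by simp only [K]; push_cast; linarith [Nat.cast_nonneg (α := ℝ) m]
  have hFK := hF.iteratedDerivWithin K
  by_cases hab : a ≤ b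
  swap
  · exact ⟨0, le_rfl, fun w h1 h2 => absurd (h1.trans h2) hab⟩
  obtain ⟨C, hC⟩ := exists_norm_mellin_le (a := a + K) (b := b + K)
    (hFK.mellinConvergent (by rw [ofReal_re]; linarith))
    (hFK.mellinConvergent (by rw [ofReal_re]; linarith))
  have hC0 : 0 ≤ C := (norm_nonneg _).trans (hC ((a + K : ℝ) : ℂ) (by simp) (by simpa using hab))
  refine ⟨C, hC0, fun w haw hwb him => ?_⟩
  rw [hF.Gamma_mul_fracDerivZero_neg (K := K) (by linarith), norm_div]
  refine div_le_div₀ hC0 (hC _ (by simpa using haw) (by simpa using hwb)) (by positivity) ?_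
  calc |w.im| ^ m ≤ |w.im| ^ K := pow_le_pow_right₀ him (by simp [K])
    _ = ∏ j ∈ Finset.range K, |w.im| := by simp
    _ ≤ ∏ j ∈ Finset.range K, ‖w + j‖ :=
      Finset.prod_le_prod (fun _ _ => abs_nonneg _) fun j _ => by simpa using abs_im_le_norm (w + j)
    _ = _ := (norm_prod _ _).symm

end HalfLineSchwartz

/-! ### Shifting vertical contours across poles. -/

section VerticalLines

theorem integrable_of_norm_le_div_sq {g : ℝ → ℂ} (hg : Continuous g) {C : ℝ}
    (hC : ∀ y : ℝ, 1 ≤ |y| → ‖g y‖ ≤ C / |y| ^ 2) : Integrable g := by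
  obtain ⟨M, hM⟩ := (isCompact_Icc (a := (-1 : ℝ)) (b := 1)).exists_bound_of_continuousOn
    hg.continuousOn
  have hM0 : 0 ≤ M := (norm_nonneg _).trans (hM 0 (by simp))
  have hC0 : 0 ≤ C := by simpa using (norm_nonneg _).trans (hC 1 (by simp))
  -- The factor `2` covers both ranges: `1 + y² ≤ 2` for `|y| ≤ 1`, and `1 + y² ≤ 2y²` for `|y| ≥
  -- 1`.
  refine (integrable_inv_one_add_sq.const_mul (2 * (M + C))).mono' hg.aestronglyMeasurable
    (ae_of_all _ fun y => ?_)
  rw [← div_eq_mul_inv, le_div_iff₀ (by positivity)]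
  rcases le_total |y| 1 with h | h
  · have h1 := hM y (abs_le.1 h)
    have h2 : y ^ 2 ≤ 1 := by rw [← sq_abs]; exact pow_le_one₀ (abs_nonneg _) h
    nlinarith [norm_nonneg (g y)]
  · have h1 := hC y h
    have h2 : 1 ≤ |y| ^ 2 := one_le_pow₀ h
    rw [le_div_iff₀ (by positivity)] at h1
    rw [sq_abs] at h1 h2
    nlinarith [norm_nonneg (g y)]

theorem continuous_verticalLine (c : ℝ) : Continuous fun y : ℝ => (c : ℂ) + y * I := by fun_prop

theorem continuous_comp_verticalLine {Q : ℂ → ℂ} {a b c : ℝ}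
    (hQ : ContinuousOn Q (re ⁻¹' Icc a b)) (hc : c ∈ Icc a b) :
    Continuous fun y : ℝ => Q (c + y * I) :=
  hQ.comp_continuous (continuous_verticalLine c) fun y => by simpa using hc

/-- Cauchy's theorem on the rectangle of height `2T`, whose horizontal sides are `O(1/T)`. Decay of
order `1/|Im w|` does not make the vertical integrals converge, hence the symmetric truncation. -/
theorem tendsto_intervalIntegral_vertical_sub {Q : ℂ → ℂ} {a b C : ℝ} (hab : a ≤ b)
    (hQ : DifferentiableOn ℂ Q (re ⁻¹' Icc a b))
    (hC : ∀ w : ℂ, a ≤ w.re → w.re ≤ b → 1 ≤ |w.im| → ‖Q w‖ ≤ C / |w.im|) :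
    Tendsto (fun T : ℝ => (∫ y in -T..T, Q (b + y * I)) - ∫ y in -T..T, Q (a + y * I))
      atTop (𝓝 0) := by
  have hlim : Tendsto (fun T : ℝ => 2 * (C / T * |b - a|)) atTop (𝓝 0) := by
    have := ((tendsto_const_nhds (x := C)).div_atTop tendsto_id).mul_const |b - a| |>.const_mul 2
    simpa using this
  refine squeeze_zero_norm' ?_ hlim
  filter_upwards [eventually_ge_atTop 1] with T hT
  have hT0 : 0 < T := by linarith
  have hrect := integral_boundary_rect_eq_zero_of_differentiableOn Q (a + (-T : ℝ) * I)
    (b + (T : ℝ) * I) (hQ.mono fun w hw => by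
      have := hw.1
      simp [uIcc_of_le hab] at this
      exact this)
  simp only [add_re, ofReal_re, mul_re, I_re, mul_zero, ofReal_im, I_im, mul_one, sub_self,
    add_zero, add_im, mul_im, zero_add, smul_eq_mul] at hrect
  have hhor : ∀ τ : ℝ, |τ| = T → ‖∫ x in a..b, Q (x + τ * I)‖ ≤ C / T * |b - a| := by
    intro τ hτ
    refine intervalIntegral.norm_integral_le_of_norm_le_const fun x hx => ?_
    rw [uIoc_of_le hab] at hx
    have := hC (x + τ * I) (by simpa using hx.1.le) (by simpa using hx.2) (by simpa [hτ] using hT)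
    simpa [hτ] using this
  have h1 := hhor T (abs_of_pos hT0)
  have h2 := hhor (-T) (by rw [abs_neg, abs_of_pos hT0])
  have hI : (∫ y in -T..T, Q (b + y * I)) - ∫ y in -T..T, Q (a + y * I) =
      I * ((∫ x in a..b, Q (x + (-T : ℝ) * I)) - ∫ x in a..b, Q (x + (T : ℝ) * I)) := by
    linear_combination (-I) * hrect + ((∫ y in -T..T, Q (b + y * I)) -
      ∫ y in -T..T, Q (a + y * I)) * I_sq
  rw [hI, norm_mul, norm_I, one_mul]
  refine (norm_sub_le _ _).trans ?_
  linarith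

theorem add_mul_I_ne_zero {δ : ℝ} (hδ : δ ≠ 0) (y : ℝ) : (δ : ℂ) + y * I ≠ 0 := fun h =>
  hδ (by simpa using congrArg re h)

theorem intervalIntegral_inv_vertical {δ : ℝ} (hδ : δ ≠ 0) (T : ℝ) :
    ∫ y in -T..T, ((δ : ℂ) + y * I)⁻¹ = ((2 * Real.arctan (T / δ) : ℝ) : ℂ) := by
  have hpos : ∀ y : ℝ, δ ^ 2 + y ^ 2 ≠ 0 := fun y => by positivity
  -- The antiderivative is a branch of `-i log(δ + iy)` up to a constant; its logarithmic part is
  -- even in `y` and cancels between `-T` and `T`.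
  have hderiv : ∀ y : ℝ, HasDerivAt
      (fun y : ℝ => ((Real.arctan (y / δ) : ℝ) : ℂ) - I / 2 * ((Real.log (δ ^ 2 + y ^ 2) : ℝ) : ℂ))
      ((δ : ℂ) + y * I)⁻¹ y := by
    intro y
    have h1 : HasDerivAt (fun y : ℝ => Real.arctan (y / δ)) (1 / (1 + (y / δ) ^ 2) * (1 / δ)) y :=
      ((hasDerivAt_id y).div_const δ).arctan
    have h2 : HasDerivAt (fun y : ℝ => Real.log (δ ^ 2 + y ^ 2)) (2 * y / (δ ^ 2 + y ^ 2)) y := by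
      have := ((hasDerivAt_pow 2 y).const_add (δ ^ 2)).log (hpos y)
      simpa using this
    refine (h1.ofReal_comp.sub (h2.ofReal_comp.const_mul (I / 2))).congr_deriv ?_
    have e1 : 1 / (1 + (y / δ) ^ 2) * (1 / δ) = δ / (δ ^ 2 + y ^ 2) := by
      have : δ ^ 2 + y ^ 2 ≠ 0 := hpos y
      field_simp
    rw [e1]
    have h3 : (δ : ℂ) ^ 2 + (y : ℂ) ^ 2 ≠ 0 := by exact_mod_cast hpos y
    have h4 := add_mul_I_ne_zero hδ y
    push_cast
    refine eq_inv_of_mul_eq_one_left ?_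
    field_simp
    linear_combination (-(y : ℂ) ^ 2) * I_sq
  rw [intervalIntegral.integral_eq_sub_of_hasDerivAt (fun y _ => hderiv y)]
  · simp [neg_div, Real.arctan_neg]
    ring
  · exact (Continuous.inv₀ (by fun_prop) (add_mul_I_ne_zero hδ)).intervalIntegrable _ _

theorem intervalIntegral_inv_sq_vertical {δ : ℝ} (hδ : δ ≠ 0) (T : ℝ) :
    ∫ y in -T..T, (((δ : ℂ) + y * I) ^ 2)⁻¹ = I / (δ + T * I) - I / (δ - T * I) := by
  have hderiv : ∀ y : ℝ, HasDerivAt (fun y : ℝ => I / ((δ : ℂ) + y * I))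
      (((δ : ℂ) + y * I) ^ 2)⁻¹ y := by
    intro y
    have h4 := add_mul_I_ne_zero hδ y
    have h1 : HasDerivAt (fun y : ℝ => (δ : ℂ) + y * I) I y := by
      simpa using ((hasDerivAt_id y).ofReal_comp.mul_const I).const_add (δ : ℂ)
    refine ((hasDerivAt_const y I).fun_div h1 h4).congr_deriv ?_
    rw [zero_mul, I_mul_I, zero_sub, neg_neg, one_div]
  rw [intervalIntegral.integral_eq_sub_of_hasDerivAt (fun y _ => hderiv y)]
  · push_cast
    ring
  · exact (Continuous.inv₀ (by fun_prop)
      fun y => pow_ne_zero 2 (add_mul_I_ne_zero hδ y)).intervalIntegrable _ _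

theorem tendsto_intervalIntegral_inv_sq_vertical {δ : ℝ} (hδ : δ ≠ 0) :
    Tendsto (fun T : ℝ => ∫ y in -T..T, (((δ : ℂ) + y * I) ^ 2)⁻¹) atTop (𝓝 0) := by
  simp_rw [intervalIntegral_inv_sq_vertical hδ]
  have hlim : Tendsto (fun T : ℝ => 2 * T⁻¹) atTop (𝓝 0) := by
    simpa using tendsto_inv_atTop_zero.const_mul (2 : ℝ)
  refine squeeze_zero_norm' ?_ hlim
  filter_upwards [eventually_gt_atTop 0] with T hT
  have key : ∀ z : ℂ, |z.im| = T → ‖I / z‖ ≤ T⁻¹ := fun z hz => by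
    rw [norm_div, norm_I, one_div]
    exact inv_anti₀ hT (hz ▸ abs_im_le_norm z)
  have h1 := key (δ + T * I) (by simp [abs_of_pos hT])
  have h2 := key (δ - T * I) (by simp [abs_of_pos hT])
  exact (norm_sub_le _ _).trans (by linarith)

/-- The limit of `arctan(T/δ)` changes sign with `δ`, and this jump is the residue of `1/(w - p)`.
-/
theorem tendsto_intervalIntegral_inv_vertical_sub {a b p : ℝ} (hap : a < p) (hpb : p < b) :
    Tendsto (fun T : ℝ => (∫ y in -T..T, (((b - p : ℝ) : ℂ) + y * I)⁻¹) -
      ∫ y in -T..T, (((a - p : ℝ) : ℂ) + y * I)⁻¹) atTop (𝓝 (2 * Real.pi)) := by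
  simp_rw [intervalIntegral_inv_vertical (sub_ne_zero.2 hap.ne),
    intervalIntegral_inv_vertical (sub_ne_zero.2 hpb.ne')]
  have h1 : Tendsto (fun T : ℝ => 2 * Real.arctan (T / (b - p)) - 2 * Real.arctan (T / (a - p)))
      atTop (𝓝 (2 * (Real.pi / 2) - 2 * (-(Real.pi / 2)))) := by
    refine Tendsto.sub (Tendsto.const_mul _ ?_) (Tendsto.const_mul _ ?_)
    · exact (Real.tendsto_arctan_atTop.mono_right nhdsWithin_le_nhds).comp
        (tendsto_id.atTop_div_const (by linarith))
    · exact (Real.tendsto_arctan_atBot.mono_right nhdsWithin_le_nhds).comp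
        (tendsto_id.atTop_div_const_of_neg (by linarith))
  have h2 := (continuous_ofReal.tendsto _).comp h1
  refine (h2.congr fun T => ?_).trans (le_of_eq ?_)
  · simp
  · congr 1
    push_cast
    ring

theorem integrable_verticalLine {H : ℂ → ℂ} {c C : ℝ}
    (hH : Continuous fun y : ℝ => H (c + y * I))
    (hC : ∀ w : ℂ, w.re = c → 1 ≤ |w.im| → ‖H w‖ ≤ C / |w.im| ^ 2) :
    Integrable fun y : ℝ => H (c + y * I) :=
  integrable_of_norm_le_div_sq hH fun y hy => by simpa using hC (c + y * I) (by simp) (by simpa)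

theorem div_sq_le_div {C y : ℝ} (hC : 0 ≤ C) (hy : 1 ≤ |y|) : C / |y| ^ 2 ≤ C / |y| :=
  div_le_div_of_nonneg_left hC (by linarith) (by nlinarith)

theorem integral_vertical_eq {H : ℂ → ℂ} {a b C : ℝ} (hab : a ≤ b)
    (hH : DifferentiableOn ℂ H (re ⁻¹' Icc a b)) (hC0 : 0 ≤ C)
    (hC : ∀ w : ℂ, a ≤ w.re → w.re ≤ b → 1 ≤ |w.im| → ‖H w‖ ≤ C / |w.im| ^ 2) :
    ∫ y : ℝ, H (b + y * I) = ∫ y : ℝ, H (a + y * I) := by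
  have hint : ∀ c ∈ Icc a b, Integrable fun y : ℝ => H (c + y * I) := fun c hc =>
    integrable_verticalLine (continuous_comp_verticalLine hH.continuousOn hc)
      fun w hw => hC w (hw ▸ hc.1) (hw ▸ hc.2)
  have h1 := (intervalIntegral_tendsto_integral (hint b ⟨hab, le_rfl⟩) tendsto_neg_atTop_atBot
    tendsto_id).sub (intervalIntegral_tendsto_integral (hint a ⟨le_rfl, hab⟩)
    tendsto_neg_atTop_atBot tendsto_id)
  have h2 := tendsto_intervalIntegral_vertical_sub hab hH
    fun w h1 h2 h3 => (hC w h1 h2 h3).trans (div_sq_le_div hC0 h3)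
  exact sub_eq_zero.1 (tendsto_nhds_unique h1 h2)

/-- Residue theorem for a pole of order at most two. The polar part is subtracted and integrated
explicitly; the holomorphic remainder contributes nothing in the limit. -/
theorem integral_vertical_sub_of_pole {H P : ℂ → ℂ} {a b p C : ℝ} (hap : a < p) (hpb : p < b)
    (hP : DifferentiableOn ℂ P (re ⁻¹' Icc a b)) (hC0 : 0 ≤ C)
    (hH : ∀ w : ℂ, a ≤ w.re → w.re ≤ b → w ≠ p → H w = P w / (w - p) ^ 2)
    (hC : ∀ w : ℂ, a ≤ w.re → w.re ≤ b → 1 ≤ |w.im| → ‖H w‖ ≤ C / |w.im| ^ 2) :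
    (∫ y : ℝ, H (b + y * I)) - ∫ y : ℝ, H (a + y * I) = 2 * Real.pi * deriv P p := by
  have hab : a < b := hap.trans hpb
  -- Second-order Taylor remainder: `P w = P p + (w - p) P'(p) + (w - p)² Q w`.
  let Q := dslope (dslope P p) p
  have hnhds : re ⁻¹' Icc a b ∈ 𝓝 (p : ℂ) :=
    continuous_re.continuousAt.preimage_mem_nhds (by simpa using Icc_mem_nhds hap hpb)
  have hQ : DifferentiableOn ℂ Q (re ⁻¹' Icc a b) :=
    (differentiableOn_dslope hnhds).2 ((differentiableOn_dslope hnhds).2 hP)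
  have hdec : ∀ w : ℂ, a ≤ w.re → w.re ≤ b → w ≠ p →
      H w = Q w + P p * ((w - p) ^ 2)⁻¹ + deriv P p * (w - p)⁻¹ := by
    intro w h1 h2 hw
    have hw' : w - p ≠ 0 := sub_ne_zero.2 hw
    rw [hH w h1 h2 hw]
    simp only [Q, dslope_of_ne _ hw, slope_def_field, dslope_same]
    field_simp
    ring
  have hQC : ∀ w : ℂ, a ≤ w.re → w.re ≤ b → 1 ≤ |w.im| →
      ‖Q w‖ ≤ (C + ‖P p‖ + ‖deriv P p‖) / |w.im| := by
    intro w h1 h2 h3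
    have hw : w ≠ p := fun h => by
      rw [h] at h3
      simp at h3
      linarith
    have him : |w.im| ≤ ‖w - p‖ := by simpa using abs_im_le_norm (w - p)
    have hpos : 0 < |w.im| := by linarith
    have e : Q w = H w - P p * ((w - p) ^ 2)⁻¹ - deriv P p * (w - p)⁻¹ := by
      rw [hdec w h1 h2 hw]; ring
    have b1 : ‖(w - p)⁻¹‖ ≤ |w.im|⁻¹ := by
      rw [norm_inv]
      exact inv_anti₀ hpos him
    have b2 : ‖((w - p) ^ 2)⁻¹‖ ≤ |w.im|⁻¹ := by
      rw [norm_inv, norm_pow]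
      exact inv_anti₀ hpos (by nlinarith)
    have b3 := (hC w h1 h2 h3).trans (div_sq_le_div hC0 h3)
    rw [e]
    calc _ ≤ ‖H w‖ + ‖P p * ((w - p) ^ 2)⁻¹‖ + ‖deriv P p * (w - p)⁻¹‖ :=
          (norm_sub_le _ _).trans (add_le_add_left (norm_sub_le _ _) _)
      _ ≤ C / |w.im| + ‖P p‖ * |w.im|⁻¹ + ‖deriv P p‖ * |w.im|⁻¹ := by
          rw [norm_mul, norm_mul]
          gcongr
      _ = _ := by ring
  have hline : ∀ c ∈ Icc a b, c ≠ p → Continuous (fun y : ℝ => H (c + y * I)) ∧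
      ∀ T : ℝ, ∫ y in -T..T, H (c + y * I) = (∫ y in -T..T, Q (c + y * I)) +
        P p * (∫ y in -T..T, ((((c - p : ℝ) : ℂ) + y * I) ^ 2)⁻¹) +
        deriv P p * ∫ y in -T..T, (((c - p : ℝ) : ℂ) + y * I)⁻¹ := by
    intro c hc hcp
    have hcp' := sub_ne_zero.2 hcp
    have e : (fun y : ℝ => H (c + y * I)) = fun y : ℝ => Q (c + y * I) +
        P p * ((((c - p : ℝ) : ℂ) + y * I) ^ 2)⁻¹ +
        deriv P p * (((c - p : ℝ) : ℂ) + y * I)⁻¹ := by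
      funext y
      have e1 : ((c - p : ℝ) : ℂ) + y * I = c + y * I - p := by push_cast; ring
      rw [e1]
      refine hdec _ (by simpa using hc.1) (by simpa using hc.2) fun h => hcp ?_
      simpa using congrArg re h
    have c1 : Continuous fun y : ℝ => Q (c + y * I) :=
      continuous_comp_verticalLine hQ.continuousOn hc
    have c2 : Continuous fun y : ℝ => P p * ((((c - p : ℝ) : ℂ) + y * I) ^ 2)⁻¹ :=
      continuous_const.mul (Continuous.inv₀ (by fun_prop)
        fun y => pow_ne_zero 2 (add_mul_I_ne_zero hcp' y))
    have c3 : Continuous fun y : ℝ => deriv P p * (((c - p : ℝ) : ℂ) + y * I)⁻¹ :=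
      continuous_const.mul (Continuous.inv₀ (by fun_prop) (add_mul_I_ne_zero hcp'))
    rw [e]
    have c12 := c1.fun_add c2
    refine ⟨c12.add c3, fun T => ?_⟩
    rw [intervalIntegral.integral_add (c12.intervalIntegrable _ _)
      (c3.intervalIntegrable _ _), intervalIntegral.integral_add (c1.intervalIntegrable _ _)
      (c2.intervalIntegrable _ _), intervalIntegral.integral_const_mul,
      intervalIntegral.integral_const_mul]
  obtain ⟨ca, ea⟩ := hline a ⟨le_rfl, hab.le⟩ hap.ne
  obtain ⟨cb, eb⟩ := hline b ⟨hab.le, le_rfl⟩ hpb.ne'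
  have h1 := (intervalIntegral_tendsto_integral (integrable_verticalLine cb
    fun w hw => hC w (hw ▸ hab.le) (hw ▸ le_rfl)) tendsto_neg_atTop_atBot tendsto_id).sub
    (intervalIntegral_tendsto_integral (integrable_verticalLine ca
    fun w hw => hC w (hw ▸ le_rfl) (hw ▸ hab.le)) tendsto_neg_atTop_atBot tendsto_id)
  have h2 := ((tendsto_intervalIntegral_vertical_sub hab.le hQ hQC).add
    (((tendsto_intervalIntegral_inv_sq_vertical (sub_ne_zero.2 hpb.ne')).sub
      (tendsto_intervalIntegral_inv_sq_vertical (sub_ne_zero.2 hap.ne))).const_mul (P p))).add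
    ((tendsto_intervalIntegral_inv_vertical_sub hap hpb).const_mul (deriv P p))
  refine (tendsto_nhds_unique h1 (h2.congr fun T => ?_)).trans (by ring)
  simp only [id_eq, ea, eb]
  ring

end VerticalLines

/-! ### Polynomial growth of `ζ` in vertical strips. -/

section ZetaGrowth

/-- `completedRiemannZeta₀` is, up to scaling, a Mellin transform that converges at every point,
hence bounded on strips. -/
theorem exists_norm_completedRiemannZeta₀_le (a b : ℝ) :
    ∃ C : ℝ, ∀ s : ℂ, a ≤ s.re → s.re ≤ b → ‖completedRiemannZeta₀ s‖ ≤ C := by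
  let P := HurwitzZeta.hurwitzEvenFEPair 0
  have hconv : ∀ s : ℂ, MellinConvergent P.f_modif s := fun s =>
    (P.isStrongFEPair_toStrongFEPair.hasMellin s).1
  obtain ⟨C, hC⟩ := exists_norm_mellin_le (hconv (a / 2 : ℝ)) (hconv (b / 2 : ℝ))
  have h2 : ∀ s : ℂ, (s / 2).re = s.re / 2 := fun s => by simp
  refine ⟨C / 2, fun s ha hb => ?_⟩
  have h3 : completedRiemannZeta₀ s = mellin P.f_modif (s / 2) / 2 := rfl
  rw [h3, norm_div, norm_ofNat]
  have := hC (s / 2) (by rw [h2]; linarith) (by rw [h2]; linarith)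
  linarith

theorem exists_norm_Gamma_le {a b : ℝ} (ha : 0 < a) (hb : 0 < b) :
    ∃ C : ℝ, ∀ s : ℂ, a ≤ s.re → s.re ≤ b → ‖Gamma s‖ ≤ C := by
  have hconv : ∀ c : ℝ, 0 < c → MellinConvergent (fun t : ℝ => (Real.exp (-t) : ℂ)) c := by
    intro c hc
    have := GammaIntegral_convergent (s := c) (by simpa using hc)
    simpa [MellinConvergent, mul_comm] using this
  obtain ⟨C, hC⟩ := exists_norm_mellin_le (hconv a ha) (hconv b hb)
  refine ⟨C, fun s h1 h2 => ?_⟩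
  rw [Gamma_eq_integral (by linarith), GammaIntegral_eq_mellin]
  exact hC s h1 h2

theorem Complex.norm_exp_mul_I_le (z : ℂ) : ‖exp (z * I)‖ ≤ Real.exp |z.im| := by
  rw [norm_exp, Real.exp_le_exp]
  simpa using neg_le_abs z.im

theorem Complex.norm_exp_neg_mul_I_le (z : ℂ) : ‖exp (-z * I)‖ ≤ Real.exp |z.im| := by
  simpa using norm_exp_mul_I_le (-z)

theorem Complex.norm_cos_le_exp (z : ℂ) : ‖cos z‖ ≤ Real.exp |z.im| := by
  rw [cos, norm_div, norm_ofNat, div_le_iff₀ (by norm_num)]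
  exact (norm_add_le _ _).trans (by linarith [norm_exp_mul_I_le z, norm_exp_neg_mul_I_le z])

theorem Complex.norm_sin_le_exp (z : ℂ) : ‖sin z‖ ≤ Real.exp |z.im| := by
  rw [sin, norm_div, norm_ofNat, div_le_iff₀ (by norm_num), norm_mul, norm_I, mul_one]
  exact (norm_sub_le _ _).trans (by linarith [norm_exp_mul_I_le z, norm_exp_neg_mul_I_le z])

/-- The reflection formula in this form turns upper bounds for `Γ` and `sin` into an upper bound for
`1/Γ`. -/
theorem Complex.inv_Gamma_eq {u : ℂ} (hu : u.re < 1) :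
    (Gamma u)⁻¹ = Gamma (1 - u) * sin (Real.pi * u) / Real.pi := by
  have h1 : Gamma (1 - u) ≠ 0 := Gamma_ne_zero_of_re_pos (by simpa using hu)
  have hpi : (Real.pi : ℂ) ≠ 0 := by exact_mod_cast Real.pi_ne_zero
  have h2 := Gamma_mul_Gamma_one_sub u
  by_cases h0 : Gamma u = 0
  · rw [h0, zero_mul, eq_comm, div_eq_zero_iff] at h2
    have h3 : sin (Real.pi * u) = 0 := h2.resolve_left hpi
    simp [h0, h3]
  · have h3 : sin (Real.pi * u) ≠ 0 := fun h => by
      rw [h, div_zero] at h2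
      exact mul_ne_zero h0 h1 h2
    rw [eq_div_iff h3] at h2
    refine inv_eq_of_mul_eq_one_right ?_
    rw [mul_div_assoc', ← mul_assoc, h2, div_self hpi]

/-- A crude a priori bound, needed only as the growth hypothesis of Phragmén–Lindelöf. The
exponential comes from `sin(πs/2)` in `1/Γ(s/2)`. -/
theorem exists_norm_riemannZeta_le_exp (a : ℝ) :
    ∃ C : ℝ, 0 ≤ C ∧ ∀ s : ℂ, a ≤ s.re → s.re ≤ 3 / 2 → 1 ≤ |s.im| →
      ‖riemannZeta s‖ ≤ C * Real.exp (Real.pi / 2 * |s.im|) := by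
  obtain ⟨C₁, h₁⟩ := exists_norm_completedRiemannZeta₀_le a (3 / 2)
  obtain ⟨C₂, h₂⟩ := exists_norm_Gamma_le (a := 1 / 4) (b := max 1 (1 - a / 2)) (by norm_num)
    (by positivity)
  refine ⟨max 0 ((C₁ + 2) * (Real.pi ^ (3 / 4 : ℝ) * (C₂ / Real.pi))), le_max_left _ _,
    fun s ha hb him => ?_⟩
  have hnorm : 1 ≤ ‖s‖ := him.trans (abs_im_le_norm s)
  have hnorm' : 1 ≤ ‖1 - s‖ := him.trans (by simpa using abs_im_le_norm (1 - s))
  have hs0 : s ≠ 0 := fun h => by simp [h] at hnorm; linarith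
  have hre : (s / 2).re = s.re / 2 := by simp
  have him2 : ((Real.pi : ℂ) * (s / 2)).im = Real.pi / 2 * s.im := by
    rw [im_ofReal_mul]; simp; ring
  have b1 : ‖completedRiemannZeta₀ s - 1 / s - 1 / (1 - s)‖ ≤ C₁ + 2 := by
    refine (norm_sub_le _ _).trans ?_
    refine (add_le_add_left (norm_sub_le _ _) _).trans ?_
    rw [norm_div, norm_div, norm_one]
    have e1 : 1 / ‖s‖ ≤ 1 := (div_le_one (by linarith)).2 hnorm
    have e2 : 1 / ‖1 - s‖ ≤ 1 := (div_le_one (by linarith)).2 hnorm'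
    linarith [h₁ s ha hb]
  have b2 : ‖((Real.pi : ℂ) ^ (-s / 2))⁻¹‖ ≤ Real.pi ^ (3 / 4 : ℝ) := by
    rw [← cpow_neg, norm_cpow_eq_rpow_re_of_pos Real.pi_pos]
    refine Real.rpow_le_rpow_of_exponent_le (by linarith [Real.pi_gt_three]) ?_
    rw [neg_div, neg_neg, hre]
    linarith
  have b3 : ‖(Gamma (s / 2))⁻¹‖ ≤ C₂ / Real.pi * Real.exp (Real.pi / 2 * |s.im|) := by
    rw [inv_Gamma_eq (by rw [hre]; linarith), norm_div, norm_mul, norm_real,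
      Real.norm_of_nonneg Real.pi_pos.le, div_mul_eq_mul_div]
    have e1 := h₂ (1 - s / 2) (by rw [sub_re, one_re, hre]; linarith)
      (by rw [sub_re, one_re, hre]; exact le_max_of_le_right (by linarith))
    have e2 := norm_sin_le_exp (Real.pi * (s / 2))
    rw [him2, abs_mul, abs_of_pos (by positivity : 0 < Real.pi / 2)] at e2
    gcongr
    exact (norm_nonneg _).trans e1
  rw [riemannZeta_eq_completedRiemannZeta₀ hs0, div_eq_mul_inv, mul_inv, norm_mul, norm_mul]
  calc _ ≤ (C₁ + 2) * (Real.pi ^ (3 / 4 : ℝ) *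
        (C₂ / Real.pi * Real.exp (Real.pi / 2 * |s.im|))) := by
        have : 0 ≤ C₁ + 2 := (norm_nonneg _).trans b1
        gcongr
    _ = (C₁ + 2) * (Real.pi ^ (3 / 4 : ℝ) * (C₂ / Real.pi)) *
        Real.exp (Real.pi / 2 * |s.im|) := by ring
    _ ≤ _ := by gcongr; exact le_max_right _ _

theorem exists_norm_riemannZeta_le_of_three_halves_le :
    ∃ C : ℝ, 0 ≤ C ∧ ∀ s : ℂ, 3 / 2 ≤ s.re → ‖riemannZeta s‖ ≤ C := by
  have hsum : Summable fun n : ℕ => 1 / (n : ℝ) ^ (3 / 2 : ℝ) :=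
    Real.summable_one_div_nat_rpow.2 (by norm_num)
  refine ⟨∑' n : ℕ, 1 / (n : ℝ) ^ (3 / 2 : ℝ), tsum_nonneg fun n => by positivity, fun s hs => ?_⟩
  rw [zeta_eq_tsum_one_div_nat_cpow (by linarith)]
  refine tsum_of_norm_bounded hsum.hasSum fun n => ?_
  rcases Nat.eq_zero_or_pos n with rfl | hn
  · have : s ≠ 0 := fun h => by simp [h] at hs; linarith
    simp [this]
  · rw [norm_div, norm_one, norm_natCast_cpow_of_pos hn]
    gcongr
    exact_mod_cast hn

/-- The reflection formula gives `|Γ(1 + iy)|² = πy / sinh(πy)` for `y ≠ 0`. This decay will cancel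
the growth of the cosine in the functional equation. -/
theorem norm_Gamma_one_add_mul_I_mul_exp_le (y : ℝ) :
    ‖Gamma (1 + y * I)‖ * Real.exp (Real.pi / 2 * |y|) ≤ 1 + 2 * Real.pi * |y| := by
  rcases eq_or_ne y 0 with rfl | hy
  · simp
  have hyC : (y : ℂ) ≠ 0 := by exact_mod_cast hy
  set x := Real.pi * |y| with hx
  have hx0 : 0 < x := mul_pos Real.pi_pos (abs_pos.2 hy)
  have hsinh : 0 < Real.sinh x := Real.sinh_pos_iff.2 hx0
  have h1 : ‖Gamma (1 + y * I)‖ ^ 2 * Real.sinh x = x := by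
    have e1 : Gamma (1 + y * I) * Gamma (1 - y * I) * (sinh (Real.pi * y)) = Real.pi * y := by
      have := Gamma_mul_Gamma_one_sub (y * I)
      have hs : sin (Real.pi * (y * I)) ≠ 0 := by
        rw [← mul_assoc, sin_mul_I]
        refine mul_ne_zero ?_ I_ne_zero
        rw [← ofReal_mul, ← ofReal_sinh]
        exact_mod_cast (Real.sinh_eq_zero.not.2 (mul_ne_zero Real.pi_ne_zero hy))
      rw [eq_div_iff hs, ← mul_assoc (Real.pi : ℂ), sin_mul_I] at this
      rw [add_comm, Gamma_add_one _ (mul_ne_zero hyC I_ne_zero)]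
      linear_combination y * this
    have e2 : Gamma (1 - y * I) = (starRingEnd ℂ) (Gamma (1 + y * I)) := by
      rw [← Gamma_conj]
      congr 1
      simp [sub_eq_add_neg]
    have e3 := congrArg norm e1
    rw [e2, norm_mul, norm_mul, RCLike.norm_conj, ← sq, ← ofReal_mul, ← ofReal_sinh, norm_real,
      norm_real, Real.norm_eq_abs, Real.norm_eq_abs, Real.abs_sinh, abs_mul,
      abs_of_pos Real.pi_pos] at e3
    exact e3
  have h2 : x * Real.exp x ≤ (1 + 2 * x) * Real.sinh x := by
    have h3 : 1 + 2 * x ≤ Real.exp x * Real.exp x := by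
      rw [← Real.exp_add]
      linarith [Real.add_one_le_exp (x + x)]
    have h4 : (1 + 2 * x) * Real.exp (-x) ≤ Real.exp x := by
      rw [Real.exp_neg, ← div_eq_mul_inv, div_le_iff₀ (Real.exp_pos x)]
      exact h3
    rw [Real.sinh_eq]
    nlinarith
  have h5 : (‖Gamma (1 + y * I)‖ * Real.exp (Real.pi / 2 * |y|)) ^ 2 ≤ 1 + 2 * x := by
    have e : Real.exp (Real.pi / 2 * |y|) ^ 2 = Real.exp x := by
      rw [sq, ← Real.exp_add]; congr 1; rw [hx]; ring
    rw [mul_pow, e]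
    refine le_of_mul_le_mul_right ?_ hsinh
    calc _ = (‖Gamma (1 + y * I)‖ ^ 2 * Real.sinh x) * Real.exp x := by ring
      _ ≤ _ := by rw [h1]; exact h2
  have h6 : (0:ℝ) ≤ ‖Gamma (1 + y * I)‖ * Real.exp (Real.pi / 2 * |y|) := by positivity
  have h7 : 2 * Real.pi * |y| = 2 * x := by rw [hx]; ring
  rw [h7]
  exact abs_le_of_sq_le_sq' (h5.trans (by nlinarith)) (by linarith) |>.2

theorem norm_Gamma_nat_add_one_add_mul_I_le (K : ℕ) (y : ℝ) :
    ‖Gamma (1 + y * I + K)‖ ≤ (1 + K + |y|) ^ K * ‖Gamma (1 + y * I)‖ := by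
  induction K with
  | zero => simp
  | succ K ih =>
    have hre : 0 < (1 + y * I + K).re := by simp; positivity
    rw [Nat.cast_succ, ← add_assoc, Gamma_add_one _ (fun h => by simp [h] at hre), norm_mul]
    have h1 : ‖1 + y * I + K‖ ≤ 1 + ((K + 1 : ℕ) : ℝ) + |y| := by
      refine (norm_add_le _ _).trans ?_
      refine (add_le_add_left (norm_add_le _ _) _).trans ?_
      simp
      linarith
    rw [pow_succ', mul_assoc]
    refine mul_le_mul h1 (ih.trans ?_) (norm_nonneg _) (by positivity)
    gcongr
    linarith

end ZetaGrowth

section ZetaGrowth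

/-- Functional equation on `Re s = -K`. An integer abscissa suffices for a strip edge, and there the
recurrence reduces `Γ(1 - s)` to the line `Re = 1`. -/
theorem exists_norm_riemannZeta_neg_nat_le {K : ℕ} (hK : 1 ≤ K) :
    ∃ C : ℝ, 0 ≤ C ∧ ∀ s : ℂ, s.re = -K → ‖riemannZeta s‖ ≤ C * (1 + K + |s.im|) ^ (K + 1) := by
  obtain ⟨Z, hZ0, hZ⟩ := exists_norm_riemannZeta_le_of_three_halves_le
  refine ⟨2 * (2 * Real.pi) * Z, by positivity, fun s hs => ?_⟩
  have hK' : (1 : ℝ) ≤ K := by exact_mod_cast hK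
  set y := -s.im with hy
  have hsy : 1 - s = 1 + y * I + K := by
    apply Complex.ext <;> simp [hs, hy]
  have hre : (1 - s).re = 1 + K := by simp [hs]
  have hfe := riemannZeta_one_sub (s := 1 - s)
    (fun n h => by
      have := congrArg re h
      rw [hre, neg_re, natCast_re] at this
      linarith [Nat.cast_nonneg (α := ℝ) n])
    (fun h => by
      have := congrArg re h
      rw [hre, one_re] at this
      linarith)
  rw [sub_sub_cancel] at hfe
  have b1 : ‖(2 * Real.pi : ℂ) ^ (-(1 - s))‖ ≤ 1 := by
    rw [show (2 * Real.pi : ℂ) = ((2 * Real.pi : ℝ) : ℂ) by push_cast; rfl,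
      norm_cpow_eq_rpow_re_of_pos (by positivity), neg_re, hre]
    exact Real.rpow_le_one_of_one_le_of_nonpos (by linarith [Real.pi_gt_three]) (by linarith)
  have b2 : ‖riemannZeta (1 - s)‖ ≤ Z := hZ _ (by rw [hre]; linarith)
  have b3 : ‖cos (Real.pi * (1 - s) / 2)‖ ≤ Real.exp (Real.pi / 2 * |y|) := by
    have e : (Real.pi * (1 - s) / 2).im = Real.pi / 2 * y := by
      rw [show Real.pi * (1 - s) / 2 = ((Real.pi / 2 : ℝ) : ℂ) * (1 - s) by push_cast; ring,
        im_ofReal_mul, hy]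
      simp
    have := norm_cos_le_exp (Real.pi * (1 - s) / 2)
    rwa [e, abs_mul, abs_of_pos (by positivity : 0 < Real.pi / 2)] at this
  have hyabs : |s.im| = |y| := by rw [hy, abs_neg]
  have b4 : ‖Gamma (1 - s)‖ * Real.exp (Real.pi / 2 * |y|) ≤
      (2 * Real.pi) * (1 + K + |y|) ^ (K + 1) := by
    have h1 := norm_Gamma_nat_add_one_add_mul_I_le K y
    have h2 := norm_Gamma_one_add_mul_I_mul_exp_le y
    rw [hsy]
    calc _ ≤ (1 + K + |y|) ^ K * ‖Gamma (1 + y * I)‖ * Real.exp (Real.pi / 2 * |y|) := by gcongr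
      _ = (1 + K + |y|) ^ K * (‖Gamma (1 + y * I)‖ * Real.exp (Real.pi / 2 * |y|)) := by ring
      _ ≤ (1 + K + |y|) ^ K * (2 * Real.pi * (1 + K + |y|)) := by
        refine mul_le_mul_of_nonneg_left (h2.trans ?_) (by positivity)
        nlinarith [Real.pi_gt_three]
      _ = _ := by ring
  rw [hfe, hyabs, norm_mul, norm_mul, norm_mul, norm_mul, norm_ofNat]
  calc _ ≤ 2 * 1 * ‖Gamma (1 - s)‖ * Real.exp (Real.pi / 2 * |y|) * Z := by gcongr
    _ = 2 * (‖Gamma (1 - s)‖ * Real.exp (Real.pi / 2 * |y|)) * Z := by ring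
    _ ≤ 2 * ((2 * Real.pi) * (1 + K + |y|) ^ (K + 1)) * Z := by gcongr
    _ = _ := by ring

theorem exists_norm_riemannZeta₁_le {K : ℕ} (hK : 1 ≤ K) :
    ∃ C : ℝ, 0 ≤ C ∧ ∀ s : ℂ, -(K : ℝ) ≤ s.re → s.re ≤ 3 / 2 →
      ‖riemannZeta₁ s‖ ≤ C * ‖s - 3‖ ^ (K + 2) := by
  obtain ⟨Z, hZ0, hZ⟩ := exists_norm_riemannZeta_le_of_three_halves_le
  obtain ⟨C₁, hC₁0, hC₁⟩ := exists_norm_riemannZeta_neg_nat_le hK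
  obtain ⟨C₂, hC₂0, hC₂⟩ := exists_norm_riemannZeta_le_exp (-K)
  have hK' : (1 : ℝ) ≤ K := by exact_mod_cast hK
  have heq : ∀ s : ℂ, s ≠ 1 → riemannZeta₁ s = (s - 1) * riemannZeta s := fun s hs => by
    rw [riemannZeta_eq_inv_sub_mul hs, mul_inv_cancel_left₀ (sub_ne_zero.2 hs)]
  -- `riemannZeta₁` removes the pole at `1`. The point `3` lies outside the strip, and the power `K
  -- + 2` absorbs the `K + 1` from the left edge and one more from `s - 1`.
  let g : ℂ → ℂ := fun s => riemannZeta₁ s / (s - 3) ^ (K + 2)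
  have hne : ∀ s : ℂ, s.re ≤ 3 / 2 → 1 ≤ ‖s - 3‖ ∧ ‖s - 1‖ ≤ 3 * ‖s - 3‖ := by
    intro s hs
    have h1 : 1 ≤ ‖s - 3‖ := by
      have h2 : |(s - 3).re| ≤ ‖s - 3‖ := abs_re_le_norm _
      have h3 : (s - 3).re = s.re - 3 := by simp
      rw [h3, abs_sub_comm] at h2
      linarith [le_abs_self (3 - s.re)]
    refine ⟨h1, ?_⟩
    have : ‖s - 1‖ ≤ ‖s - 3‖ + ‖(2 : ℂ)‖ := by
      simpa [show s - 3 + 2 = s - 1 by ring] using norm_add_le (s - 3) 2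
    rw [norm_ofNat] at this
    linarith
  set M := max (3 * Z) (3 * (C₁ * (4 : ℝ) ^ (K + 1))) with hM
  have key : ∀ s : ℂ, -(K : ℝ) ≤ s.re → s.re ≤ 3 / 2 → ‖g s‖ ≤ M := by
    intro s hs1 hs2
    refine PhragmenLindelof.vertical_strip (a := -(K : ℝ)) (b := 3 / 2) ?_ ?_ ?_ ?_ hs1 hs2
    · have : DifferentiableOn ℂ g {s | s.re < 2} := by
        refine differentiable_riemannZeta₁.differentiableOn.div
          (by fun_prop) fun s hs => pow_ne_zero _ (sub_ne_zero.2 fun h => ?_)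
        rw [h] at hs
        norm_num at hs
      refine (this.mono ?_).diffContOnCl
      intro s hs
      have hs' := closure_minimal (preimage_mono Ioo_subset_Icc_self)
        (isClosed_Icc.preimage continuous_re) hs
      have := hs'.2
      exact lt_of_le_of_lt this (by norm_num)
    -- Phragmén–Lindelöf allows growth `exp(B exp(c|Im s|))` with `c` below `π / width`. Here `c = 1
    -- / width`, and `B = (π/2)/c` makes this dominate `exp((π/2)|Im s|)`.
    · set c : ℝ := 1 / (3 / 2 - -(K : ℝ)) with hc
      have hlen : 0 < 3 / 2 - -(K : ℝ) := by linarith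
      have hc0 : 0 < c := by positivity
      refine ⟨c, ?_, Real.pi / 2 / c, IsBigO.of_bound (3 * C₂) ?_⟩
      · rw [hc]
        exact div_lt_div_of_pos_right (by linarith [Real.pi_gt_three]) hlen
      · have hev : ∀ᶠ s : ℂ in comap (_root_.abs ∘ im) atTop, 1 ≤ |s.im| :=
          (tendsto_comap (f := _root_.abs ∘ im) (x := atTop)).eventually (eventually_ge_atTop 1)
        rw [eventually_inf_principal]
        filter_upwards [hev] with s him hs
        have hs1 : s ≠ 1 := fun h => by simp [h] at him; linarith
        obtain ⟨h1, h2⟩ := hne s hs.2.le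
        have h3 : ‖s - 1‖ / ‖s - 3‖ ^ (K + 2) ≤ 3 := by
          rw [div_le_iff₀ (by positivity)]
          refine h2.trans ?_
          gcongr
          exact le_self_pow₀ h1 (by simp)
        have h4 := hC₂ s hs.1.le hs.2.le him
        have h5 : Real.pi / 2 * |s.im| ≤ Real.pi / 2 / c * Real.exp (c * |s.im|) := by
          have := Real.add_one_le_exp (c * |s.im|)
          calc Real.pi / 2 * |s.im| = Real.pi / 2 / c * (c * |s.im|) := by field_simp
            _ ≤ _ := by gcongr; linarith
        simp only [g]
        rw [Real.norm_of_nonneg (Real.exp_pos _).le, norm_div, heq s hs1, norm_mul, norm_pow,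
          mul_div_right_comm]
        calc _ ≤ 3 * (C₂ * Real.exp (Real.pi / 2 * |s.im|)) := by gcongr
          _ ≤ 3 * (C₂ * Real.exp (Real.pi / 2 / c * Real.exp (c * |s.im|))) := by gcongr
          _ = _ := by ring
    · intro s hs
      obtain ⟨h1, h2⟩ := hne s (by linarith)
      have hs1 : s ≠ 1 := fun h => by simp [h] at hs; linarith
      have h4 := hC₁ s hs
      have h5 : 1 + K + |s.im| ≤ 4 * ‖s - 3‖ := by
        have e1 : |s.im| ≤ ‖s - 3‖ := by simpa using abs_im_le_norm (s - 3)
        have e2 : |(s - 3).re| ≤ ‖s - 3‖ := abs_re_le_norm _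
        have e3 : (s - 3).re = -(K + 3) := by simp [hs]; ring
        rw [e3, abs_neg, abs_of_pos (by positivity)] at e2
        linarith
      refine le_max_of_le_right ?_
      simp only [g]
      rw [norm_div, heq s hs1, norm_mul, norm_pow, div_le_iff₀ (by positivity)]
      calc _ ≤ 3 * ‖s - 3‖ * (C₁ * (4 * ‖s - 3‖) ^ (K + 1)) := by
            refine mul_le_mul h2 (h4.trans ?_) (norm_nonneg _) (by positivity)
            gcongr
        _ = _ := by rw [mul_pow]; ring
    · intro s hs
      obtain ⟨h1, h2⟩ := hne s hs.le
      have hs1 : s ≠ 1 := fun h => by simp [h] at hs; norm_num at hs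
      have h4 := hZ s hs.ge
      refine le_max_of_le_left ?_
      simp only [g]
      rw [norm_div, heq s hs1, norm_mul, norm_pow, div_le_iff₀ (by positivity)]
      calc _ ≤ 3 * ‖s - 3‖ * Z := by gcongr
        _ = 3 * Z * ‖s - 3‖ := by ring
        _ ≤ _ := by gcongr; exact le_self_pow₀ h1 (by simp)
  refine ⟨M, le_max_of_le_left (by positivity), fun s hs1 hs2 => ?_⟩
  have h := key s hs1 hs2
  have h1 := (hne s hs2).1
  simp only [g] at h
  rwa [norm_div, norm_pow, div_le_iff₀ (by positivity)] at h

theorem exists_norm_riemannZeta_le_pow (a : ℝ) :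
    ∃ (C : ℝ) (m : ℕ), 0 ≤ C ∧ ∀ s : ℂ, a ≤ s.re → s.re ≤ 3 / 2 → 1 ≤ |s.im| →
      ‖riemannZeta s‖ ≤ C * |s.im| ^ m := by
  obtain ⟨n, hn⟩ := exists_nat_ge (-a)
  obtain ⟨C, hC0, hC⟩ := exists_norm_riemannZeta₁_le (K := n + 1) (by simp)
  refine ⟨C * (n + 5) ^ (n + 1 + 2), n + 1 + 2, by positivity, fun s ha hb him => ?_⟩
  have hs1 : s ≠ 1 := fun h => by simp [h] at him; linarith
  have h1 : 1 ≤ ‖s - 1‖ := him.trans (by simpa using abs_im_le_norm (s - 1))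
  have h2 := hC s (by push_cast; linarith) hb
  have h3 : ‖s - 3‖ ≤ (n + 5) * |s.im| := by
    refine (norm_le_abs_re_add_abs_im _).trans ?_
    have e : |(s - 3).re| ≤ n + 4 := by
      rw [abs_le]
      constructor <;> simp <;> linarith [Nat.cast_nonneg (α := ℝ) n]
    have e2 : (s - 3).im = s.im := by simp
    rw [e2]
    nlinarith [Nat.cast_nonneg (α := ℝ) n]
  rw [riemannZeta_eq_inv_sub_mul hs1, norm_mul, norm_inv]
  calc _ ≤ 1 * (C * ((n + 5) * |s.im|) ^ (n + 1 + 2)) := by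
        refine mul_le_mul (inv_le_one_of_one_le₀ h1) (h2.trans ?_) (norm_nonneg _) zero_le_one
        gcongr
    _ = _ := by rw [mul_pow]; ring

end ZetaGrowth

/-! ### The Dirichlet series of the divisor function. -/

section DivisorSeries

open ArithmeticFunction in
theorem LSeriesHasSum_card_divisors {s : ℂ} (hs : 1 < s.re) :
    LSeriesHasSum (fun n => (n.divisors.card : ℂ)) s (riemannZeta s ^ 2) := by
  let Z : ArithmeticFunction ℂ := (ArithmeticFunction.zeta : ArithmeticFunction ℂ)
  have hZ : LSeriesHasSum (fun n => Z n) s (riemannZeta s) := by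
    simpa [Z] using LSeriesHasSum_zeta hs
  have h := LSeriesHasSum_mul hZ hZ
  rw [← sq (riemannZeta s)] at h
  refine (LSeriesHasSum_congr s _ fun {n} _ => ?_).1 h
  simp only [Z, coe_zeta_mul_apply]
  rw [Finset.sum_congr rfl (g := fun _ => (1 : ℂ))]
  · simp
  · intro i hi
    have : i ≠ 0 := (Nat.pos_of_mem_divisors hi).ne'
    simp [this]

theorem hasSum_card_divisors_mul_cpow_neg {s : ℂ} (hs : 1 < s.re) :
    HasSum (fun n : ℕ => ((n + 1).divisors.card : ℂ) * (((n + 1 : ℕ) : ℝ) : ℂ) ^ (-s))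
      (riemannZeta s ^ 2) := by
  have h := LSeriesHasSum_card_divisors hs
  unfold LSeriesHasSum at h
  rw [← hasSum_nat_add_iff' 1] at h
  simp only [Finset.range_one, Finset.sum_singleton, LSeries.term_zero, sub_zero] at h
  refine h.congr_fun fun n => ?_
  rw [LSeries.term_of_ne_zero n.succ_ne_zero, cpow_neg, div_eq_mul_inv, ofReal_natCast]

end DivisorSeries

/-! ### Vertical integrals under `s ↦ -s`. -/

section VerticalLineIntegral

theorem verticalLineIntegral_eq (c : ℝ) (f : ℂ → ℂ) :
    verticalLineIntegral c f = 1 / (2 * Real.pi) * ∫ y : ℝ, f (c + y * I) := by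
  rw [verticalLineIntegral, integral_mul_const]
  field_simp

theorem verticalLineIntegral_neg_comp_neg (c : ℝ) (f : ℂ → ℂ) :
    verticalLineIntegral (-c) (fun s => f (-s)) = verticalLineIntegral c f := by
  rw [verticalLineIntegral_eq, verticalLineIntegral_eq,
    ← integral_neg_eq_self (fun y : ℝ => f (c + y * I))]
  congr 2 with y
  congr 1
  push_cast
  ring

theorem Complex.VerticalIntegrable.comp_neg {c : ℝ} {f : ℂ → ℂ} (h : VerticalIntegrable f c) :
    VerticalIntegrable (fun s => f (-s)) (-c) := by
  refine (Integrable.comp_neg h).congr (ae_of_all _ fun y => ?_)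
  simp only
  congr 1
  push_cast
  ring

end VerticalLineIntegral

/-- The integrand of the Euler–Voronoï formula, in the variable `-s`. -/
noncomputable def voronoiIntegrand (F : ℝ → ℂ) (x : ℝ) (w : ℂ) : ℂ :=
  riemannZeta w ^ 2 * Complex.Gamma w * fracDerivZero F (-w) * (x : ℂ) ^ (-w)

/-! ### The integrand: decay, regularity, and the sum as an integral over `Re w = 3/2`. -/

namespace HalfLineSchwartz

variable {F : ℝ → ℂ} {x : ℝ}

theorem exists_norm_voronoiIntegrand_le (hF : HalfLineSchwartz 0 F) (hx : 0 < x) (a : ℝ) :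
    ∃ C : ℝ, 0 ≤ C ∧ ∀ w : ℂ, a ≤ w.re → w.re ≤ 3 / 2 → 1 ≤ |w.im| →
      ‖voronoiIntegrand F x w‖ ≤ C / |w.im| ^ 2 := by
  obtain ⟨C₁, m, hC₁0, hC₁⟩ := exists_norm_riemannZeta_le_pow a
  -- Order `2m + 2` compensates the growth `|Im w|^(2m)` of `ζ²` and leaves `|Im w|⁻²`.
  obtain ⟨C₂, hC₂0, hC₂⟩ := hF.exists_norm_Gamma_mul_fracDerivZero_le a (3 / 2) (2 * m + 2)
  refine ⟨C₁ ^ 2 * C₂ * (x ^ (-a) + x ^ (-(3 / 2 : ℝ))), by positivity, fun w ha hb him => ?_⟩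
  have hpos : 0 < |w.im| := by linarith
  have b1 := hC₁ w ha hb him
  have b2 := hC₂ w ha hb him
  have b3 : ‖(x : ℂ) ^ (-w)‖ ≤ x ^ (-a) + x ^ (-(3 / 2 : ℝ)) := by
    rw [norm_cpow_eq_rpow_re_of_pos hx, neg_re]
    have p1 : 0 ≤ x ^ (-a) := by positivity
    have p2 : 0 ≤ x ^ (-(3 / 2 : ℝ)) := by positivity
    rcases le_total 1 x with h | h
    · linarith [Real.rpow_le_rpow_of_exponent_le h (neg_le_neg ha)]
    · linarith [Real.rpow_le_rpow_of_exponent_ge hx h (neg_le_neg hb)]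
  rw [voronoiIntegrand, mul_assoc (riemannZeta w ^ 2), norm_mul, norm_mul, norm_pow]
  calc _ ≤ (C₁ * |w.im| ^ m) ^ 2 * (C₂ / |w.im| ^ (2 * m + 2)) *
        (x ^ (-a) + x ^ (-(3 / 2 : ℝ))) := by gcongr
    _ = _ := by
      field_simp
      ring

theorem differentiableAt_voronoiIntegrand (hF : HalfLineSchwartz 0 F) (hx : 0 < x) {w : ℂ}
    (h1 : w ≠ 1) (hw : ∀ m : ℕ, w ≠ -m) : DifferentiableAt ℂ (voronoiIntegrand F x) w := by
  have hx' : (x : ℂ) ≠ 0 := by exact_mod_cast hx.ne'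
  have hD := hF.isEntireFracDeriv_fracDerivZero.entire
  exact ((((differentiableAt_riemannZeta h1).pow 2).mul (differentiableAt_Gamma w hw)).mul
    ((hD (-w)).comp w differentiable_neg.differentiableAt)).mul
    (differentiableAt_neg_iff.2 differentiableAt_id |>.const_cpow (Or.inl hx'))

theorem continuous_voronoiIntegrand_line (hF : HalfLineSchwartz 0 F) (hx : 0 < x) {c : ℝ}
    (h1 : c ≠ 1) (hc : ∀ m : ℕ, c ≠ -m) :
    Continuous fun y : ℝ => voronoiIntegrand F x (c + y * I) := by
  rw [continuous_iff_continuousAt]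
  intro y
  have hre : ((c : ℂ) + y * I).re = c := by simp
  refine ContinuousAt.comp (g := voronoiIntegrand F x)
    (hF.differentiableAt_voronoiIntegrand hx (fun h => h1 ?_) fun m h => hc m ?_).continuousAt
    (continuous_verticalLine c).continuousAt
  · rw [← hre, h, one_re]
  · rw [← hre, h]; simp

theorem verticalIntegrable_voronoiIntegrand (hF : HalfLineSchwartz 0 F) (hx : 0 < x) {c : ℝ}
    (hc : c ≤ 3 / 2) (hcont : Continuous fun y : ℝ => voronoiIntegrand F x (c + y * I)) :
    VerticalIntegrable (voronoiIntegrand F x) c := by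
  obtain ⟨C, -, hC⟩ := hF.exists_norm_voronoiIntegrand_le hx c
  exact integrable_verticalLine hcont fun w hw => hC w hw.ge (by linarith)

theorem verticalIntegrable_mellin (hF : HalfLineSchwartz 0 F) {c : ℝ} (hc : 0 < c) :
    VerticalIntegrable (mellin fun u => F (-u)) c := by
  obtain ⟨C, -, hC⟩ := hF.exists_norm_Gamma_mul_fracDerivZero_le c c 2
  refine integrable_verticalLine (C := C) ?_ fun w hw him => ?_
  · rw [continuous_iff_continuousAt]
    intro y
    exact ContinuousAt.comp (g := mellin fun u => F (-u))
      (hF.differentiableAt_mellin (by simpa using hc)).continuousAt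
      (continuous_verticalLine c).continuousAt
  · rw [← hF.Gamma_mul_fracDerivZero_neg_of_re_pos (hw ▸ hc)]
    exact hC w hw.ge hw.le him

theorem eq_integral_mellin (hF : HalfLineSchwartz 0 F) {c u : ℝ} (hc : 0 < c) (hu : 0 < u) :
    F (-u) = 1 / (2 * Real.pi) *
      ∫ y : ℝ, (u : ℂ) ^ (-(c + y * I)) * mellin (fun u => F (-u)) (c + y * I) := by
  have h := mellinInv_mellin_eq c (fun u => F (-u)) hu (hF.mellinConvergent (by simpa using hc))
    (hF.verticalIntegrable_mellin hc) (hF.hasDerivAt hu).continuousAt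
  rw [← h, mellinInv, real_smul]
  push_cast
  rfl

/-- Sum and integral are exchanged because `∑ d_n n^{-3/2}` and `∫ |M|` both converge. `HasSum` in
`ℂ` is unconditional, so it includes absolute convergence. -/
theorem hasSum_verticalLineIntegral (hF : HalfLineSchwartz 0 F) (hx : 0 < x) :
    HasSum (fun n : ℕ => ((n + 1).divisors.card : ℂ) * F (((n + 1 : ℕ) : ℝ) * -x))
      (verticalLineIntegral (3 / 2) (voronoiIntegrand F x)) := by
  set M := mellin fun u => F (-u) with hM
  have hMint : Integrable fun y : ℝ => M ((3 / 2 : ℝ) + y * I) :=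
    hF.verticalIntegrable_mellin (by norm_num)
  let G : ℕ → ℝ → ℂ := fun n y => ((n + 1).divisors.card : ℂ) *
    (((((n + 1 : ℕ) : ℝ) * x : ℝ) : ℂ) ^ (-((3 / 2 : ℝ) + y * I)) * M ((3 / 2 : ℝ) + y * I))
  have hsplit : ∀ (n : ℕ) (s : ℂ), ((((n + 1 : ℕ) : ℝ) * x : ℝ) : ℂ) ^ s =
      (((n + 1 : ℕ) : ℝ) : ℂ) ^ s * (x : ℂ) ^ s := fun n s => by
    rw [ofReal_mul, mul_cpow_ofReal_nonneg (by positivity) hx.le]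
  have hnorm : ∀ n y, ‖G n y‖ = (((n + 1).divisors.card : ℝ) *
      ((n + 1 : ℕ) : ℝ) ^ (-(3 / 2 : ℝ)) * x ^ (-(3 / 2 : ℝ))) * ‖M ((3 / 2 : ℝ) + y * I)‖ := by
    intro n y
    have hn : (0 : ℝ) < ((n + 1 : ℕ) : ℝ) := by positivity
    simp only [G]
    rw [norm_mul, norm_natCast, norm_mul, norm_cpow_eq_rpow_re_of_pos (by positivity)]
    have : (-(((3 / 2 : ℝ) : ℂ) + y * I)).re = -(3 / 2) := by simp
    rw [this, Real.mul_rpow hn.le hx.le]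
    ring
  have hGint : ∀ n, Integrable (G n) := by
    intro n
    have hcont : Continuous fun y : ℝ =>
        ((((n + 1 : ℕ) : ℝ) * x : ℝ) : ℂ) ^ (-(((3 / 2 : ℝ) : ℂ) + y * I)) := by
      refine Continuous.const_cpow (by fun_prop) (Or.inl ?_)
      exact_mod_cast (by positivity : ((n + 1 : ℕ) : ℝ) * x ≠ 0)
    refine (hMint.norm.const_mul (((n + 1).divisors.card : ℝ) *
      ((n + 1 : ℕ) : ℝ) ^ (-(3 / 2 : ℝ)) * x ^ (-(3 / 2 : ℝ)))).mono'
      ((hcont.aestronglyMeasurable.mul hMint.aestronglyMeasurable).const_mul _)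
      (ae_of_all _ fun y => (hnorm n y).le)
  have hsummable : Summable fun n : ℕ => ((n + 1).divisors.card : ℝ) *
      ((n + 1 : ℕ) : ℝ) ^ (-(3 / 2 : ℝ)) := by
    have h := (hasSum_card_divisors_mul_cpow_neg (s := (3 / 2 : ℝ))
      (by rw [ofReal_re]; norm_num)).summable.norm
    refine h.congr fun n => ?_
    rw [norm_mul, norm_natCast, norm_cpow_eq_rpow_re_of_pos (by positivity), neg_re, ofReal_re]
  have hGsum : Summable fun n => ∫ y, ‖G n y‖ := by
    simp_rw [hnorm, integral_const_mul]
    exact (hsummable.mul_right _).mul_right _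
  have key := (hasSum_integral_of_summable_integral_norm hGint hGsum).mul_left
    (1 / (2 * (Real.pi : ℂ)))
  have htsum : ∀ y : ℝ, ∑' n, G n y = voronoiIntegrand F x ((3 / 2 : ℝ) + y * I) := by
    intro y
    set s : ℂ := (3 / 2 : ℝ) + y * I with hs
    have hre : s.re = 3 / 2 := by simp [hs]
    have h := (hasSum_card_divisors_mul_cpow_neg (s := s) (by rw [hre]; norm_num)).mul_right
      ((x : ℂ) ^ (-s) * M s)
    refine (h.congr_fun fun n => ?_).tsum_eq.trans ?_
    · simp only [G]
      rw [← hs, hsplit]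
      ring
    · rw [voronoiIntegrand, mul_assoc (riemannZeta s ^ 2),
        hF.Gamma_mul_fracDerivZero_neg_of_re_pos (by rw [hre]; norm_num)]
      ring
  simp_rw [htsum] at key
  rw [verticalLineIntegral_eq]
  refine key.congr_fun fun n => ?_
  simp only [G, integral_const_mul]
  rw [mul_neg, hF.eq_integral_mellin (c := 3 / 2) (by norm_num)
    (by positivity : 0 < ((n + 1 : ℕ) : ℝ) * x)]
  ring

end HalfLineSchwartz

/-! ### Residues at `1` and at `0, -1, -2, …`, and the removable singularities. -/

/-- A simple pole is the double-pole case with `P w = (w - p) R w`, for which `P'(p) = R p`. -/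
theorem integral_vertical_sub_of_simple_pole {H R : ℂ → ℂ} {a b p C : ℝ} (hap : a < p)
    (hpb : p < b) (hR : DifferentiableOn ℂ R (re ⁻¹' Icc a b)) (hC0 : 0 ≤ C)
    (hH : ∀ w : ℂ, a ≤ w.re → w.re ≤ b → w ≠ p → H w = R w / (w - p))
    (hC : ∀ w : ℂ, a ≤ w.re → w.re ≤ b → 1 ≤ |w.im| → ‖H w‖ ≤ C / |w.im| ^ 2) :
    (∫ y : ℝ, H (b + y * I)) - ∫ y : ℝ, H (a + y * I) = 2 * Real.pi * R p := by
  have hnhds : re ⁻¹' Icc a b ∈ 𝓝 (p : ℂ) :=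
    continuous_re.continuousAt.preimage_mem_nhds (by simpa using Icc_mem_nhds hap hpb)
  rw [integral_vertical_sub_of_pole (P := fun w => (w - p) * R w) hap hpb
    (DifferentiableOn.mul (by fun_prop) hR) hC0 (fun w h1 h2 h3 => ?_) hC]
  · have := ((hasDerivAt_id (p : ℂ)).sub_const (p : ℂ)).mul
      (hR.differentiableAt hnhds).hasDerivAt
    simp only [id_eq, sub_self, one_mul, zero_mul, add_zero] at this
    rw [← this.deriv]
    rfl
  · have : w - p ≠ 0 := sub_ne_zero.2 h3
    rw [hH w h1 h2 h3]
    field_simp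

theorem prod_range_neg_add (k : ℕ) :
    ∏ j ∈ Finset.range k, (-(k : ℂ) + j) = (-1) ^ k * (k.factorial : ℂ) := by
  rw [← Finset.prod_range_reflect, ← Finset.prod_range_add_one_eq_factorial]
  push_cast
  rw [← Finset.card_range k, ← Finset.prod_const, Finset.card_range, ← Finset.prod_mul_distrib]
  refine Finset.prod_congr rfl fun j hj => ?_
  have : j + 1 ≤ k := Finset.mem_range.1 hj
  rw [Nat.sub_sub, Nat.cast_sub (by omega)]
  push_cast
  ring

namespace HalfLineSchwartz

variable {F : ℝ → ℂ} {x : ℝ}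

theorem integral_voronoiIntegrand_sub_at_one (hF : HalfLineSchwartz 0 F) (hx : 0 < x) :
    (∫ y : ℝ, voronoiIntegrand F x ((3 / 2 : ℝ) + y * I)) -
      ∫ y : ℝ, voronoiIntegrand F x ((1 / 2 : ℝ) + y * I) =
    2 * Real.pi * ((x : ℂ)⁻¹ * (mellin (fun u => Real.log u • F (-u)) 1 +
      (2 * Real.eulerMascheroniConstant - Real.log x) * mellin (fun u => F (-u)) 1)) := by
  obtain ⟨C, hC0, hC⟩ := hF.exists_norm_voronoiIntegrand_le hx (1 / 2)
  have hx' : (x : ℂ) ≠ 0 := by exact_mod_cast hx.ne'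
  have hpow : ∀ w : ℂ, HasDerivAt (fun w : ℂ => (x : ℂ) ^ (-w))
      ((x : ℂ) ^ (-w) * Complex.log x * -1) w := fun w =>
    (hasDerivAt_neg w).const_cpow (Or.inl hx')
  set M := mellin fun u => F (-u) with hM
  -- The residue is `P'(1)`: differentiating `riemannZeta₁²` gives `2γ`, `M` gives the logarithm
  -- under the integral, and `x^(-w)` gives `-log x`.
  let P : ℂ → ℂ := fun w => riemannZeta₁ w ^ 2 * M w * (x : ℂ) ^ (-w)
  have hP : DifferentiableOn ℂ P (re ⁻¹' Icc (1 / 2) (3 / 2)) := by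
    intro w hw
    refine (((differentiable_riemannZeta₁ w).pow 2).mul (hF.differentiableAt_mellin ?_)
      |>.mul (hpow w).differentiableAt).differentiableWithinAt
    have := hw.1
    linarith
  rw [integral_vertical_sub_of_pole (p := 1) (P := P) (by norm_num) (by norm_num) hP hC0
    (fun w h1 h2 h3 => ?_) hC]
  · have h1 := (((differentiable_riemannZeta₁ 1).hasDerivAt.pow 2).mul
      (hF.mellin_hasDerivAt (z := 1) (by simp)).2).mul (hpow 1)
    rw [ofReal_one]
    congr 1
    refine h1.deriv.trans ?_
    simp only [Pi.mul_apply, Pi.pow_apply, riemannZeta₁_one, deriv_riemannZeta₁_one, ← hM,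
      cpow_neg_one, ← ofReal_log hx.le]
    push_cast
    ring
  · rw [ofReal_one] at h3 ⊢
    have : w - 1 ≠ 0 := sub_ne_zero.2 h3
    rw [voronoiIntegrand, mul_assoc (riemannZeta w ^ 2),
      hF.Gamma_mul_fracDerivZero_neg_of_re_pos (by linarith), riemannZeta_eq_inv_sub_mul h3]
    simp only [P, hM]
    field_simp

/-- With `k + 1` integrations by parts the formula reaches past `-k`, and the factor `w + k`
isolates the pole there. -/
theorem voronoiIntegrand_eq_div (hF : HalfLineSchwartz 0 F) {k : ℕ} {w : ℂ}
    (hw : -((k + 1 : ℕ) : ℝ) < w.re) : voronoiIntegrand F x w =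
      riemannZeta w ^ 2 * (mellin (fun u => _root_.iteratedDerivWithin (k + 1) F (Iic 0) (-u))
        (w + (k + 1 : ℕ)) / ∏ j ∈ Finset.range k, (w + j)) * (x : ℂ) ^ (-w) / (w + k) := by
  rw [voronoiIntegrand, mul_assoc (riemannZeta w ^ 2), hF.Gamma_mul_fracDerivZero_neg hw,
    Finset.prod_range_succ, ← div_div]
  ring

theorem differentiableAt_mellin_div_prod (hF : HalfLineSchwartz 0 F) {k : ℕ} {w : ℂ}
    (hw : -((k + 1 : ℕ) : ℝ) < w.re) (hw' : w.re < -k + 1) :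
    DifferentiableAt ℂ (fun w => mellin
      (fun u => _root_.iteratedDerivWithin (k + 1) F (Iic 0) (-u)) (w + (k + 1 : ℕ)) /
        ∏ j ∈ Finset.range k, (w + j)) w := by
  refine DifferentiableAt.fun_div ?_ (by fun_prop) (Finset.prod_ne_zero_iff.2 fun j hj h => ?_)
  · refine DifferentiableAt.comp (g := mellin
      (fun u => _root_.iteratedDerivWithin (k + 1) F (Iic 0) (-u))) w
      ((hF.iteratedDerivWithin (k + 1)).differentiableAt_mellin ?_) (by fun_prop)
    rw [add_re, natCast_re]
    linarith
  · have h1 : w.re + j = 0 := by simpa using congrArg re h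
    have h2 : (j : ℝ) + 1 ≤ k := by exact_mod_cast Finset.mem_range.1 hj
    linarith

theorem integral_voronoiIntegrand_sub_at_neg (hF : HalfLineSchwartz 0 F) (hx : 0 < x) (k : ℕ) :
    (∫ y : ℝ, voronoiIntegrand F x ((-k + 1 / 2 : ℝ) + y * I)) -
      ∫ y : ℝ, voronoiIntegrand F x ((-k - 1 / 2 : ℝ) + y * I) =
    2 * Real.pi * (riemannZeta (-k) ^ 2 / (k.factorial : ℂ) * (-(x : ℂ)) ^ k *
      _root_.iteratedDerivWithin k F (Iic 0) 0) := by
  obtain ⟨C, hC0, hC⟩ := hF.exists_norm_voronoiIntegrand_le hx (-k - 1 / 2)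
  have hx' : (x : ℂ) ≠ 0 := by exact_mod_cast hx.ne'
  have hk : (0 : ℝ) ≤ k := Nat.cast_nonneg k
  let R : ℂ → ℂ := fun w => riemannZeta w ^ 2 *
    (mellin (fun u => _root_.iteratedDerivWithin (k + 1) F (Iic 0) (-u)) (w + (k + 1 : ℕ)) /
      ∏ j ∈ Finset.range k, (w + j)) * (x : ℂ) ^ (-w)
  have hR : DifferentiableOn ℂ R (re ⁻¹' Icc (-k - 1 / 2) (-k + 1 / 2)) := by
    intro w hw
    have h1 : -k - 1 / 2 ≤ w.re := hw.1
    have h2 : w.re ≤ -k + 1 / 2 := hw.2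
    have hw1 : w ≠ 1 := fun h => by rw [h, one_re] at h2; linarith
    have d1 := hF.differentiableAt_mellin_div_prod (k := k) (w := w) (by push_cast; linarith)
      (by linarith)
    have d2 : DifferentiableAt ℂ (fun w : ℂ => (x : ℂ) ^ (-w)) w :=
      (differentiableAt_neg_iff.2 differentiableAt_id).const_cpow (Or.inl hx')
    exact ((((differentiableAt_riemannZeta hw1).pow 2).mul d1).mul d2).differentiableWithinAt
  have hp : ((-k : ℝ) : ℂ) = -k := by push_cast; rfl
  have hRp : R (-k) = riemannZeta (-k) ^ 2 / (k.factorial : ℂ) * (-(x : ℂ)) ^ k *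
      _root_.iteratedDerivWithin k F (Iic 0) 0 := by
    have e1 : (-(k : ℂ) + (k + 1 : ℕ)) = 1 := by push_cast; ring
    simp only [R]
    rw [e1, hF.mellin_iteratedDerivWithin_succ_one, prod_range_neg_add, neg_neg, cpow_natCast,
      neg_pow (x : ℂ)]
    have h0 : ((-1 : ℂ) ^ k) * (-1) ^ k = 1 := by rw [← mul_pow]; simp
    have h1 : (-1 : ℂ) ^ k ≠ 0 := by simp
    have h2 : (k.factorial : ℂ) ≠ 0 := by exact_mod_cast k.factorial_ne_zero
    rw [← mul_div_assoc, div_mul_eq_mul_div, div_mul_eq_mul_div, div_mul_eq_mul_div,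
      div_eq_div_iff (mul_ne_zero h1 h2) h2]
    linear_combination (-(riemannZeta (-k) ^ 2 * (x : ℂ) ^ k * k.factorial *
      _root_.iteratedDerivWithin k F (Iic 0) 0)) * h0
  rw [integral_vertical_sub_of_simple_pole (p := -k) (by linarith) (by linarith) hR hC0
    (fun w h1 h2 h3 => ?_) (fun w h1 h2 h3 => hC w h1 (by linarith) h3), hp, hRp]
  rw [hF.voronoiIntegrand_eq_div (k := k) (by push_cast; linarith), hp, sub_neg_eq_add]

theorem integral_voronoiIntegrand_sub_sum (hF : HalfLineSchwartz 0 F) (hx : 0 < x) (n : ℕ) :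
    (∫ y : ℝ, voronoiIntegrand F x ((1 / 2 : ℝ) + y * I)) =
      2 * Real.pi * (∑ k ∈ Finset.range n, riemannZeta (-k) ^ 2 / (k.factorial : ℂ) *
        (-(x : ℂ)) ^ k * _root_.iteratedDerivWithin k F (Iic 0) 0) +
      ∫ y : ℝ, voronoiIntegrand F x ((-n + 1 / 2 : ℝ) + y * I) := by
  induction n with
  | zero => simp
  | succ n ih =>
    have h := hF.integral_voronoiIntegrand_sub_at_neg hx n
    rw [ih, Finset.sum_range_succ, mul_add, ← h,
      show (-((n + 1 : ℕ) : ℝ) + 1 / 2) = -n - 1 / 2 by push_cast; ring]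
    ring

/-- One zero of `ζ²` at `-2N` cancels `w + 2N`; the other makes the regularised value `0`. This
agrees with the default value of the integrand at that point, so no redefinition is needed. -/
theorem differentiableOn_voronoiIntegrand_even (hF : HalfLineSchwartz 0 F) (hx : 0 < x) {N : ℕ}
    (hN : 1 ≤ N) : DifferentiableOn ℂ (voronoiIntegrand F x)
      (re ⁻¹' Icc (-((2 * N : ℕ) : ℝ)) (-((2 * N : ℕ) : ℝ) + 1 / 2)) := by
  have hx' : (x : ℂ) ≠ 0 := by exact_mod_cast hx.ne'
  set k := 2 * N with hk
  have hk2 : (2 : ℝ) ≤ k := by exact_mod_cast (by omega : 2 ≤ k)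
  have hzero : riemannZeta (-k) = 0 := by
    have := riemannZeta_neg_two_mul_nat_add_one (N - 1)
    rw [Nat.cast_sub hN] at this
    rw [← this, hk]
    congr 1
    push_cast
    ring
  let S : Set ℂ := {w | w.re < 1}
  have hS : IsOpen S := isOpen_lt continuous_re continuous_const
  have hmem : -(k : ℂ) ∈ S := by
    change (-(k : ℂ)).re < 1
    simp
    linarith
  have hζ : DifferentiableOn ℂ riemannZeta S := fun w hw =>
    (differentiableAt_riemannZeta fun h => by
      rw [h] at hw
      exact lt_irrefl (1 : ℝ) hw).differentiableWithinAt
  have hslope := (differentiableOn_dslope (hS.mem_nhds hmem)).2 hζ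
  -- As `ζ(-k) = 0`, the quotient `ζ(w)² / (w + k)` is `ζ(w)` times the slope of `ζ` at `-k`.
  have hdiff : DifferentiableOn ℂ (fun w => riemannZeta w * dslope riemannZeta (-k) w *
      (mellin (fun u => _root_.iteratedDerivWithin (k + 1) F (Iic 0) (-u))
        (w + (k + 1 : ℕ)) / ∏ j ∈ Finset.range k, (w + j)) * (x : ℂ) ^ (-w))
      (re ⁻¹' Icc (-(k : ℝ)) (-(k : ℝ) + 1 / 2)) := by
    intro w hw
    have h1 : -(k : ℝ) ≤ w.re := hw.1
    have h2 : w.re ≤ -k + 1 / 2 := hw.2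
    have hwS : S ∈ 𝓝 w := hS.mem_nhds (show w.re < 1 by linarith)
    exact ((((hζ.differentiableAt hwS).mul (hslope.differentiableAt hwS)).mul
      (hF.differentiableAt_mellin_div_prod (by push_cast; linarith) (by linarith))).mul
      (differentiableAt_neg_iff.2 differentiableAt_id |>.const_cpow
        (Or.inl hx'))).differentiableWithinAt
  refine hdiff.congr fun w hw => ?_
  have h1 : -(k : ℝ) ≤ w.re := hw.1
  rw [hF.voronoiIntegrand_eq_div (k := k) (by push_cast; linarith)]
  rcases eq_or_ne w (-k) with rfl | hne
  · simp [hzero]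
  · have : w + k ≠ 0 := fun h => hne (eq_neg_of_add_eq_zero_left h)
    rw [dslope_of_ne _ hne, slope_def_field, hzero, sub_neg_eq_add, sub_zero]
    ring

theorem sum_range_two_mul_eq {r : ℕ → ℂ} (h0 : ∀ n : ℕ, 1 ≤ n → r (2 * n) = 0) {N : ℕ}
    (hN : 1 ≤ N) :
    ∑ k ∈ Finset.range (2 * N), r k = r 0 + ∑ n ∈ Finset.Icc 1 N, r (2 * n - 1) := by
  induction N, hN using Nat.le_induction with
  | base => simp [Finset.sum_range_succ]
  | succ N hN ih =>
    rw [show 2 * (N + 1) = 2 * N + 1 + 1 by ring, Finset.sum_range_succ, Finset.sum_range_succ, ih,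
      h0 N hN, Finset.sum_Icc_succ_top (by omega), show 2 * (N + 1) - 1 = 2 * N + 1 by omega]
    ring

end HalfLineSchwartz

/-! ### Assembling the expansion of order `N`. -/

namespace HalfLineSchwartz

variable {F : ℝ → ℂ} {x : ℝ}

theorem mellin_log_add_eq (hF : HalfLineSchwartz 0 F) (hx : 0 < x) :
    IntegrableOn (fun u : ℝ => F (-u) *
      ((Real.log (u / x) + 2 * Real.eulerMascheroniConstant : ℝ) : ℂ)) (Ioi 0) ∧
    ∫ u in Ioi (0 : ℝ), F (-u) *
      ((Real.log (u / x) + 2 * Real.eulerMascheroniConstant : ℝ) : ℂ) =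
      mellin (fun u => Real.log u • F (-u)) 1 +
        (2 * Real.eulerMascheroniConstant - Real.log x) * mellin (fun u => F (-u)) 1 := by
  have hM := hF.mellinConvergent (z := 1) (by simp)
  have hL := (hF.mellin_hasDerivAt (z := 1) (by simp)).1
  simp only [MellinConvergent, mellin, sub_self, cpow_zero, one_smul] at hM hL ⊢
  have hEq : EqOn (fun u : ℝ => Real.log u • F (-u) +
      (2 * Real.eulerMascheroniConstant - Real.log x : ℂ) * F (-u))
      (fun u : ℝ => F (-u) *
        ((Real.log (u / x) + 2 * Real.eulerMascheroniConstant : ℝ) : ℂ)) (Ioi 0) := by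
    intro u hu
    simp only
    rw [Real.log_div (ne_of_gt hu) hx.ne', real_smul]
    push_cast
    ring
  have hM' := hM.const_mul (2 * Real.eulerMascheroniConstant - Real.log x : ℂ)
  refine ⟨(hL.add hM').congr_fun hEq measurableSet_Ioi, ?_⟩
  rw [← setIntegral_congr_fun measurableSet_Ioi hEq, integral_add hL hM', integral_const_mul]

theorem verticalLineIntegral_voronoiIntegrand_eq (hF : HalfLineSchwartz 0 F) (hx : 0 < x) {N : ℕ}
    (hN : 1 ≤ N) : verticalLineIntegral (3 / 2) (voronoiIntegrand F x) =
      1 / (x : ℂ) * (∫ u in Ioi (0 : ℝ), F (-u) *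
        ((Real.log (u / x) + 2 * Real.eulerMascheroniConstant : ℝ) : ℂ)) + F 0 / 4 +
      (∑ n ∈ Finset.Icc 1 N, riemannZeta (1 - 2 * (n : ℂ)) ^ 2 / ((2 * n - 1).factorial : ℂ) *
        (-(x : ℂ)) ^ (2 * n - 1) * _root_.iteratedDerivWithin (2 * n - 1) F (Iic 0) 0) +
      verticalLineIntegral (-(2 * (N : ℝ))) (voronoiIntegrand F x) := by
  obtain ⟨C, hC0, hC⟩ := hF.exists_norm_voronoiIntegrand_le hx (-((2 * N : ℕ) : ℝ))
  have hpi : (Real.pi : ℂ) ≠ 0 := by exact_mod_cast Real.pi_ne_zero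
  have h1 := hF.integral_voronoiIntegrand_sub_at_one hx
  -- This shift crosses the poles `0, …, -(2N - 1)` and stops at `Re w = -2N + 1/2`; the last half
  -- unit, to the line through `-2N`, crosses none.
  have h2 := hF.integral_voronoiIntegrand_sub_sum hx (2 * N)
  have h3 := integral_vertical_eq (by linarith) (hF.differentiableOn_voronoiIntegrand_even hx hN)
    hC0 fun w ha hb => hC w ha (by linarith [Nat.cast_nonneg (α := ℝ) (2 * N)])
  have hvan : ∀ n : ℕ, 1 ≤ n → riemannZeta (-((2 * n : ℕ) : ℂ)) ^ 2 / ((2 * n).factorial : ℂ) *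
      (-(x : ℂ)) ^ (2 * n) * _root_.iteratedDerivWithin (2 * n) F (Iic 0) 0 = 0 := by
    intro n hn
    have := riemannZeta_neg_two_mul_nat_add_one (n - 1)
    rw [Nat.cast_sub hn] at this
    rw [show (-((2 * n : ℕ) : ℂ)) = -2 * ((n : ℂ) - (1 : ℕ) + 1) by push_cast; ring, this]
    simp
  have h4 := sum_range_two_mul_eq (r := fun k => riemannZeta (-k) ^ 2 / (k.factorial : ℂ) *
    (-(x : ℂ)) ^ k * _root_.iteratedDerivWithin k F (Iic 0) 0) hvan hN
  have h5 : riemannZeta (-((0 : ℕ) : ℂ)) ^ 2 / ((0 : ℕ).factorial : ℂ) * (-(x : ℂ)) ^ 0 *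
      _root_.iteratedDerivWithin 0 F (Iic 0) 0 = F 0 / 4 := by
    simp [riemannZeta_zero]
    ring
  have h6 : ∑ n ∈ Finset.Icc 1 N, riemannZeta (-((2 * n - 1 : ℕ) : ℂ)) ^ 2 /
        ((2 * n - 1).factorial : ℂ) * (-(x : ℂ)) ^ (2 * n - 1) *
        _root_.iteratedDerivWithin (2 * n - 1) F (Iic 0) 0 =
      ∑ n ∈ Finset.Icc 1 N, riemannZeta (1 - 2 * (n : ℂ)) ^ 2 / ((2 * n - 1).factorial : ℂ) *
        (-(x : ℂ)) ^ (2 * n - 1) * _root_.iteratedDerivWithin (2 * n - 1) F (Iic 0) 0 := by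
    refine Finset.sum_congr rfl fun n hn => ?_
    have : 1 ≤ n := (Finset.mem_Icc.1 hn).1
    rw [Nat.cast_sub (by omega)]
    push_cast
    rw [neg_sub]
  rw [h5, h6] at h4
  have h7 : verticalLineIntegral (-(2 * (N : ℝ))) (voronoiIntegrand F x) =
      1 / (2 * Real.pi) *
        ∫ y : ℝ, voronoiIntegrand F x ((-((2 * N : ℕ) : ℝ) : ℝ) + y * I) := by
    rw [verticalLineIntegral_eq, Nat.cast_mul, Nat.cast_ofNat]
  rw [(hF.mellin_log_add_eq hx).2, h7, verticalLineIntegral_eq, ← h3, sub_eq_iff_eq_add.1 h1, h2, h4]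
  have halg : ∀ A S J Y c : ℂ, 1 / (2 * (Real.pi : ℂ)) * (2 * Real.pi * (Y⁻¹ * A) +
      (2 * Real.pi * (c + S) + J)) = 1 / Y * A + c + S + 1 / (2 * Real.pi) * J := by
    intro A S J Y c
    field_simp
    ring
  exact halg _ _ _ _ _

end HalfLineSchwartz

end EulerVoronoi

theorem mainTheorem4 (F : ℝ → ℂ) (hF : HalfLineSchwartz 0 F) :
    -- the function `s ↦ F^{(s)}(0)` is well defined on the whole plane
    IsEntireFracDeriv F (fracDerivZero F) ∧
    ∀ t : ℝ, t < 0 →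
      -- the sum as an integral over `Re s = 3/2`
      Complex.VerticalIntegrable
        (fun s : ℂ => riemannZeta s ^ 2 * Complex.Gamma s * fracDerivZero F (-s) *
          ((-t : ℝ) : ℂ) ^ (-s)) (3 / 2) ∧
      HasSum (fun n : ℕ => ((n + 1).divisors.card : ℂ) * F (((n + 1 : ℕ) : ℝ) * t))
        (verticalLineIntegral (3 / 2)
          (fun s : ℂ => riemannZeta s ^ 2 * Complex.Gamma s * fracDerivZero F (-s) *
            ((-t : ℝ) : ℂ) ^ (-s))) ∧
      -- the sum as an integral over `Re s = -3/2`
      Complex.VerticalIntegrable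
        (fun s : ℂ => riemannZeta (-s) ^ 2 * Complex.Gamma (-s) * fracDerivZero F s *
          ((-t : ℝ) : ℂ) ^ s) (-(3 / 2)) ∧
      HasSum (fun n : ℕ => ((n + 1).divisors.card : ℂ) * F (((n + 1 : ℕ) : ℝ) * t))
        (verticalLineIntegral (-(3 / 2))
          (fun s : ℂ => riemannZeta (-s) ^ 2 * Complex.Gamma (-s) * fracDerivZero F s *
            ((-t : ℝ) : ℂ) ^ s)) ∧
      -- the expansion of any order `N ≥ 1`, with its remainder
      MeasureTheory.IntegrableOn
        (fun u : ℝ => F (-u) *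
          ((Real.log (u / (-t)) + 2 * Real.eulerMascheroniConstant : ℝ) : ℂ))
        (Set.Ioi 0) ∧
      ∀ N : ℕ, 1 ≤ N →
        Complex.VerticalIntegrable
          (fun s : ℂ => Complex.Gamma (-s) * riemannZeta (-s) ^ 2 * fracDerivZero F s *
            ((-t : ℝ) : ℂ) ^ s) (2 * (N : ℝ)) ∧
        HasSum (fun n : ℕ => ((n + 1).divisors.card : ℂ) * F (((n + 1 : ℕ) : ℝ) * t))
          (-(1 / (t : ℂ)) * (∫ u in Set.Ioi (0 : ℝ), F (-u) *
              ((Real.log (u / (-t)) + 2 * Real.eulerMascheroniConstant : ℝ) : ℂ))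
            + F 0 / 4
            + (∑ n ∈ Finset.Icc 1 N,
                riemannZeta (1 - 2 * (n : ℂ)) ^ 2 / ((2 * n - 1).factorial : ℂ)
                  * (t : ℂ) ^ (2 * n - 1)
                  * iteratedDerivWithin (2 * n - 1) F (Set.Iic 0) 0)
            + verticalLineIntegral (2 * (N : ℝ))
                (fun s : ℂ => Complex.Gamma (-s) * riemannZeta (-s) ^ 2 * fracDerivZero F s *
                  ((-t : ℝ) : ℂ) ^ s)) := by
  refine ⟨hF.isEntireFracDeriv_fracDerivZero, fun t ht => ?_⟩
  obtain ⟨x, rfl⟩ : ∃ x : ℝ, t = -x := ⟨-t, by ring⟩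
  have hx : 0 < x := by linarith
  have hint : Complex.VerticalIntegrable (voronoiIntegrand F x) (3 / 2) :=
    hF.verticalIntegrable_voronoiIntegrand hx le_rfl
      (hF.continuous_voronoiIntegrand_line hx (by norm_num) fun m h => by
        linarith [Nat.cast_nonneg (α := ℝ) m])
  have hsum := hF.hasSum_verticalLineIntegral hx
  have hreflect : (fun s : ℂ => riemannZeta (-s) ^ 2 * Complex.Gamma (-s) * fracDerivZero F s *
      (x : ℂ) ^ s) = fun s => voronoiIntegrand F x (-s) := by
    funext s
    simp [voronoiIntegrand]
  have hreflect' : (fun s : ℂ => Complex.Gamma (-s) * riemannZeta (-s) ^ 2 * fracDerivZero F s *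
      (x : ℂ) ^ s) = fun s => voronoiIntegrand F x (-s) := by
    rw [← hreflect]
    funext s
    ring
  simp only [neg_neg, hreflect, hreflect']
  refine ⟨hint, hsum, hint.comp_neg, ?_, (hF.mellin_log_add_eq hx).1, fun N hN => ⟨?_, ?_⟩⟩
  · rw [verticalLineIntegral_neg_comp_neg]
    exact hsum
  -- The line is the left edge of the closed strip on which the integrand is differentiable, so it
  -- is continuous there even at `w = -2N`.
  · have hcont := continuous_comp_verticalLine (c := -((2 * N : ℕ) : ℝ))
      (hF.differentiableOn_voronoiIntegrand_even hx hN).continuousOn ⟨le_rfl, by linarith⟩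
    have h := (hF.verticalIntegrable_voronoiIntegrand hx
      (by linarith [Nat.cast_nonneg (α := ℝ) (2 * N)]) hcont).comp_neg
    simpa using h
  · have h := verticalLineIntegral_neg_comp_neg (-(2 * (N : ℝ))) (voronoiIntegrand F x)
    rw [neg_neg] at h
    rw [h]
    convert hsum using 1
    rw [hF.verticalLineIntegral_voronoiIntegrand_eq hx hN]
    push_cast
    rw [one_div_neg_eq_neg_one_div, neg_neg]
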